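/- Let $\mathcal H$ be a real Hilbert space, $N\ge 1$, and let $F_i:\mathcal H\to\mathcal H$ ($i=1,\dots,N$) satisfy $\|F_i(x)-F_i(y)\|\le L_i\|x-y\|$ for all $x,y\in\mathcal H$, with $L_i>0$. Put $F=\frac1N\sum_{i=1}^N F_i$ and assume: (a) $\mathrm{Fix}(F)\neq\emptyset$ and $F$ is quasi-nonexpansive: $\|F(x)-y\|\le\|x-y\|$ for all $x\in\mathcal H$, $y\in \mathrm{Fix}(F)$; (b) $F$ is linearly regular with constant $\kappa>0$: $\inf_{y\in \mathrm{Fix}(F)}\|x-y\|\le\kappa\|F(x)-x\|$ for all $x\in\mathcal H$. Let $\mathcal G$ be a strongly connected directed graph on $\{1,\dots,N\}$. Let $A=(a_{ij})$ be a row-stochastic and $B=(b_{ij})$ a column-stochastic $N\times N$ matrix with $a_{ii},b_{ii}>0$ for all $i$ and, for $i\ne j$, $a_{ij}>0\iff b_{ij}>0\iff (j,i)$ is an edge of $\mathcal G$. Let $\pi$ and $\nu$ be the stochastic vectors (nonnegative entries summing to $1$; their entries are then positive) with $\pi^\top A=\pi^\top$ and $B\nu=\nu$, and let $A_\infty=\lim_k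 A^k$, $B_\infty=\lim_k B^k$. On $\mathbb R^N$ let $\|\cdot\|$ be the Euclidean norm, $\|x\|_\pi=\sqrt{\sum_i\pi_i x_i^2}$ and $\|x\|_\nu=\sqrt{\sum_i x_i^2/\nu_i}$, and use the same symbols for the induced matrix norms. Let $c_1,c_2,c_3,c_4>0$ be any constants with $c_1\|x\|\le\|x\|_\pi\le c_2\|x\|$ and $c_3\|x\|_\nu\le\|x\|_\pi\le c_4\|x\|_\nu$ for all $x\in\mathbb R^N$. Let $\delta\in(0,1)$, $D_\nu=\mathrm{diag}(\nu_1,\dots,\nu_N)$, $\bar L=\max_i L_i$, $\rho_1=\|A-A_\infty\|_\pi$, $\rho_2=\|B-B_\infty\|_\nu$, $\theta_1=\frac{c_4\|D_\nu^{-1}\|}{N}$, $\theta_2=\frac{c_2\bar L(\sqrt N+1)}{c_1c_3}$, $\theta_3=\rho_1+\bar L$, $\theta_4=\|A-I\|$, and $$M(\alpha)=\begin{pmatrix}(1-\alpha)\rho_1&\alpha c_2\theta_1&0\\ \theta_2(\alpha\theta_3+\theta_4)&\rho_2+\alpha\theta_1\theta_2&2\alpha c_1\theta_2\\ \frac{\alpha\bar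 L}{c_1}&\frac{\alpha\sqrt N\theta_1}{c_1}&1-\frac{\delta\alpha}{4\kappa^2}\end{pmatrix}.$$ Then the equation $\det(I-M(\alpha))=0$ has a smallest positive real root $\alpha_c$, and for every stepsize $\alpha$ with $0<\alpha<\min\{1-\delta,\alpha_c\}$ there is $r\in[0,1)$ such that the following holds. For arbitrary $x_{i,0}\in\mathcal H$ ($i=1,\dots,N$), let $y_{i,0}=F_i(x_{i,0})$ and, for $k\ge0$ and all $i$, $$x_{i,k+1}=\sum_{j=1}^N a_{ij}x_{j,k}+\alpha\Big(\frac{y_{i,k}}{N\nu_i}-\sum_{j=1}^N a_{ij}x_{j,k}\Big),\qquad y_{i,k+1}=\sum_{j=1}^N b_{ij}y_{j,k}+F_i(x_{i,k+1})-F_i(x_{i,k}).$$ Then there are $x^*\in \mathrm{Fix}(F)$ and $C\in\mathbb R$ with $\|x_{i,k}-x^*\|\le C r^k$ for all $i\in\{1,\dots,N\}$ and all $k\ge0$; that is, all $x_{i,k}$ converge to the common point $x^*$ of $\mathrm{Fix}(F)$ at a linear rate. -/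

import Mathlib

open Filter Topology
open scoped Matrix

noncomputable section

namespace DOT

/-! ### Operators -/

section Operators

variable {H : Type*} [NormedAddCommGroup H] [InnerProductSpace ℝ H]

/-- `T` is Lipschitz with constant `L > 0`. -/
def IsLipschitz (T : H → H) (L : ℝ) : Prop :=
  0 < L ∧ ∀ x y, ‖T x - T y‖ ≤ L * ‖x - y‖

/-- `T` is quasi-nonexpansive: `‖T x - T y‖ ≤ ‖x - y‖` for all `x` and all `y ∈ Fix(T)`. -/
def IsQuasiNonexpansive (T : H → H) : Prop :=
  ∀ x, ∀ y ∈ Function.fixedPoints T, ‖T x - T y‖ ≤ ‖x - y‖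

/-- `T` is linearly regular with constant `κ > 0`. -/
def IsLinearlyRegular (T : H → H) (κ : ℝ) : Prop :=
  0 < κ ∧ ∀ x, Metric.infDist x (Function.fixedPoints T) ≤ κ * ‖T x - x‖

/-- The sum-separable global operator `(1 / N) ∑ i, F i`. -/
def globalOp {N : ℕ} (F : Fin N → H → H) : H → H :=
  fun x => (1 / (N : ℝ)) • ∑ i, F i x

/-- The sequences `x k i` and `y k i` are generated by the DOT algorithm with stepsize `α`,
communication matrices `A`, `B`, from an arbitrary starting point `x 0`. -/
structure IsTrajectory {N : ℕ} (F : Fin N → H → H) (A B : Matrix (Fin N) (Fin N) ℝ)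
    (ν : Fin N → ℝ) (α : ℝ) (x y : ℕ → Fin N → H) : Prop where
  init : ∀ i, y 0 i = F i (x 0 i)
  step_x : ∀ k i, x (k + 1) i =
    (∑ j, A i j • x k j) + α • ((1 / (N * ν i)) • y k i - ∑ j, A i j • x k j)
  step_y : ∀ k i, y (k + 1) i =
    (∑ j, B i j • y k j) + F i (x (k + 1) i) - F i (x k i)

end Operators

/-! ### Communication graph and matrices -/

/-- Any node can be reached from any other one along a directed path. -/
def IsStronglyConnected {V : Type*} (G : Digraph V) : Prop :=
  ∀ i j, Relation.ReflTransGen G.Adj i j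

/-- `M` has positive diagonal and, for `i ≠ j`, `M i j > 0` iff `(j, i)` is an edge. -/
def IsConsistent {N : ℕ} (G : Digraph (Fin N)) (M : Matrix (Fin N) (Fin N) ℝ) : Prop :=
  (∀ i, 0 < M i i) ∧ ∀ i j, i ≠ j → (0 < M i j ↔ G.Adj j i)

/-- The infinite power `lim M ^ k`. -/
def infPower {N : ℕ} (M : Matrix (Fin N) (Fin N) ℝ) : Matrix (Fin N) (Fin N) ℝ :=
  limUnder atTop (fun k : ℕ => M ^ k)

/-! ### Norms -/

/-- The weighted Euclidean norm `√(∑ i, w i * x i ^ 2)`. -/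
def weightedNorm {N : ℕ} (w : Fin N → ℝ) (x : Fin N → ℝ) : ℝ :=
  √(∑ i, w i * x i ^ 2)

/-- `‖x‖_π = √(∑ i, π i * x i ^ 2)`. -/
def normPi {N : ℕ} (π : Fin N → ℝ) : (Fin N → ℝ) → ℝ := weightedNorm π

/-- `‖x‖_ν = √(∑ i, x i ^ 2 / ν i)`. -/
def normNu {N : ℕ} (ν : Fin N → ℝ) : (Fin N → ℝ) → ℝ := weightedNorm (fun i => (ν i)⁻¹)

/-- The natural Euclidean norm on vectors. -/
def normE {N : ℕ} (x : Fin N → ℝ) : ℝ := ‖WithLp.toLp 2 x‖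

/-- The matrix norm induced by the vector norm `p`. -/
def inducedNorm {N : ℕ} (p : (Fin N → ℝ) → ℝ) (M : Matrix (Fin N) (Fin N) ℝ) : ℝ :=
  sInf {c : ℝ | 0 ≤ c ∧ ∀ x, p (M *ᵥ x) ≤ c * p x}

/-- The matrix norm induced by the Euclidean norm. -/
def opNormE {N : ℕ} (M : Matrix (Fin N) (Fin N) ℝ) : ℝ :=
  ‖Matrix.toEuclideanCLM (n := Fin N) (𝕜 := ℝ) M‖

/-- Positive constants with `c₁ ‖x‖ ≤ ‖x‖_π ≤ c₂ ‖x‖` and `c₃ ‖x‖_ν ≤ ‖x‖_π ≤ c₄ ‖x‖_ν`. -/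
structure NormConstants {N : ℕ} (π ν : Fin N → ℝ) (c₁ c₂ c₃ c₄ : ℝ) : Prop where
  pos₁ : 0 < c₁
  pos₂ : 0 < c₂
  pos₃ : 0 < c₃
  pos₄ : 0 < c₄
  lower_pi : ∀ x, c₁ * normE x ≤ normPi π x
  upper_pi : ∀ x, normPi π x ≤ c₂ * normE x
  lower_nu : ∀ x, c₃ * normNu ν x ≤ normPi π x
  upper_nu : ∀ x, normPi π x ≤ c₄ * normNu ν x

/-! ### The matrix `M(α)` -/

/-- `ρ₁ = ‖A - A_∞‖_π`. -/
def rho₁ {N : ℕ} (A : Matrix (Fin N) (Fin N) ℝ) (π : Fin N → ℝ) : ℝ :=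
  inducedNorm (normPi π) (A - infPower A)

/-- `ρ₂ = ‖B - B_∞‖_ν`. -/
def rho₂ {N : ℕ} (B : Matrix (Fin N) (Fin N) ℝ) (ν : Fin N → ℝ) : ℝ :=
  inducedNorm (normNu ν) (B - infPower B)

/-- `θ₁ = c₄ ‖D_ν⁻¹‖ / N` with `D_ν = diag(ν)`. -/
def theta₁ {N : ℕ} (ν : Fin N → ℝ) (c₄ : ℝ) : ℝ :=
  c₄ * opNormE (Matrix.diagonal ν)⁻¹ / N

/-- `θ₂ = c₂ L (√N + 1) / (c₁ c₃)`. -/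
def theta₂ (N : ℕ) (c₁ c₂ c₃ Lbar : ℝ) : ℝ :=
  c₂ * Lbar * (√(N : ℝ) + 1) / (c₁ * c₃)

/-- `θ₃ = ρ₁ + L`. -/
def theta₃ {N : ℕ} (A : Matrix (Fin N) (Fin N) ℝ) (π : Fin N → ℝ) (Lbar : ℝ) : ℝ :=
  rho₁ A π + Lbar

/-- `θ₄ = ‖A - I‖`. -/
def theta₄ {N : ℕ} (A : Matrix (Fin N) (Fin N) ℝ) : ℝ :=
  opNormE (A - 1)

/-- The matrix `M(α)`; here `Lbar` stands for the largest Lipschitz constant. -/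
def matM {N : ℕ} (A B : Matrix (Fin N) (Fin N) ℝ) (π ν : Fin N → ℝ)
    (c₁ c₂ c₃ c₄ Lbar κ δ α : ℝ) : Matrix (Fin 3) (Fin 3) ℝ :=
  !![(1 - α) * rho₁ A π,
      α * c₂ * theta₁ ν c₄,
      0;
    theta₂ N c₁ c₂ c₃ Lbar * (α * theta₃ A π Lbar + theta₄ A),
      rho₂ B ν + α * theta₁ ν c₄ * theta₂ N c₁ c₂ c₃ Lbar,
      2 * α * c₁ * theta₂ N c₁ c₂ c₃ Lbar;
    α * Lbar / c₁,
      α * √(N : ℝ) * theta₁ ν c₄ / c₁,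
      1 - δ * α / (4 * κ ^ 2)]

end DOT

end

/-! The method is an inexact relaxation step for the global operator at the `π`-weighted mean of the
`x k i`. Because `B` is column-stochastic, the sum of the `y k i` always equals the sum of the `F i
(x k i)`. If the nodes agreed and `y k` were proportional to `ν`, the mean would therefore move
exactly by `m + α (F m - m)`. Three quantities measure the failure: the consensus error of `x k`,
the tracking error of `y k`, and the distance of the mean to the fixed point set.

Consensus and tracking contract because `A` and `B`, minus their limits, have norm below one in the
`π`- and `ν`-norms (`rho₁_spec`, `rho₂_spec`); the distance contracts by quasi-nonexpansiveness and
linear regularity (`infDist_relaxation_le`). The cross terms are Lipschitz estimates, so the error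
triple, with its first entry scaled by `c₂`, is dominated at each step by `M(α)` applied to the
previous triple.

The determinant of `I - M(α)` is `α` times a function that is positive at zero, hence positive up to
its first root. For such a matrix with nonpositive off-diagonal entries this yields a positive
vector `v` with `M v ≤ r v` and `r < 1` (`exists_positive_contracted_vector`), so the triple decays
like `r ^ k`. The increments of the mean are bounded by the triple; the mean is thus Cauchy, and its
limit lies in the closed fixed point set. -/

noncomputable section
namespace DOT

/-! ### Weighted norms on families of Hilbert space vectors -/

section WeightedNorm

variable {ι : Type*} [Fintype ι] {H : Type*} [NormedAddCommGroup H] [InnerProductSpace ℝ H]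

/-- The weighted `ℓ²` norm of a finite family of vectors. -/
def wnorm (w : ι → ℝ) (x : ι → H) : ℝ := ‖WithLp.toLp 2 (fun i => √(w i) • x i)‖

theorem wnorm_nonneg (w : ι → ℝ) (x : ι → H) : 0 ≤ wnorm w x := norm_nonneg _

theorem wnorm_sq {w : ι → ℝ} (hw : ∀ i, 0 ≤ w i) (x : ι → H) :
    wnorm w x ^ 2 = ∑ i, w i * ‖x i‖ ^ 2 := by
  unfold wnorm
  rw [PiLp.norm_sq_eq_of_L2]
  refine Finset.sum_congr rfl fun i _ => ?_
  simp only [norm_smul, mul_pow, Real.norm_eq_abs, sq_abs, Real.sq_sqrt (hw i)]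

theorem wnorm_add_le (w : ι → ℝ) (x y : ι → H) :
    wnorm w (fun i => x i + y i) ≤ wnorm w x + wnorm w y := by
  unfold wnorm
  refine le_trans (le_of_eq ?_) (norm_add_le _ _)
  congr 1
  ext i
  simp

theorem wnorm_smul (w : ι → ℝ) (c : ℝ) (x : ι → H) :
    wnorm w (fun i => c • x i) = |c| * wnorm w x := by
  unfold wnorm
  rw [← Real.norm_eq_abs, ← norm_smul]
  congr 1
  ext i
  exact smul_comm _ _ _

theorem wnorm_zero (w : ι → ℝ) : wnorm w (0 : ι → H) = 0 := by
  have := wnorm_smul w 0 (0 : ι → H)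
  simp only [Pi.zero_apply, smul_zero, abs_zero, zero_mul] at this
  exact this

theorem wnorm_neg (w : ι → ℝ) (x : ι → H) : wnorm w (fun i => - x i) = wnorm w x := by
  simpa using wnorm_smul w (-1) x

theorem wnorm_le_of_sq_le {w w' : ι → ℝ} (hw : ∀ i, 0 ≤ w i) (hw' : ∀ i, 0 ≤ w' i)
    {E : Type*} [NormedAddCommGroup E] [InnerProductSpace ℝ E]
    {x : ι → H} {y : ι → E} {c : ℝ} (hc : 0 ≤ c)
    (h : ∑ i, w i * ‖x i‖ ^ 2 ≤ c ^ 2 * ∑ i, w' i * ‖y i‖ ^ 2) :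
    wnorm w x ≤ c * wnorm w' y := by
  refine abs_le_of_sq_le_sq' ?_ (mul_nonneg hc (wnorm_nonneg _ _)) |>.2
  rw [mul_pow, wnorm_sq hw, wnorm_sq hw']
  exact h

theorem wnorm_le_of_pointwise {w w' : ι → ℝ} (hw : ∀ i, 0 ≤ w i) (hw' : ∀ i, 0 ≤ w' i)
    {E : Type*} [NormedAddCommGroup E] [InnerProductSpace ℝ E]
    {x : ι → H} {y : ι → E} {c : ℝ} (hc : 0 ≤ c)
    (h : ∀ i, w i * ‖x i‖ ^ 2 ≤ c ^ 2 * (w' i * ‖y i‖ ^ 2)) :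
    wnorm w x ≤ c * wnorm w' y := by
  refine wnorm_le_of_sq_le hw hw' hc ?_
  rw [Finset.mul_sum]
  exact Finset.sum_le_sum fun i _ => h i

theorem wnorm_eq_of_pointwise {w w' : ι → ℝ} (hw : ∀ i, 0 ≤ w i) (hw' : ∀ i, 0 ≤ w' i)
    {E : Type*} [NormedAddCommGroup E] [InnerProductSpace ℝ E]
    {x : ι → H} {y : ι → E}
    (h : ∀ i, w i * ‖x i‖ ^ 2 = w' i * ‖y i‖ ^ 2) :
    wnorm w x = wnorm w' y := by
  apply le_antisymm
  · simpa using wnorm_le_of_pointwise hw hw' zero_le_one (x := x) (y := y)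
      (fun i => by rw [h i]; simp)
  · simpa using wnorm_le_of_pointwise hw' hw zero_le_one (x := y) (y := x)
      (fun i => by rw [h i]; simp)

/-- The weighted variance identity. -/
theorem sum_weight_norm_sub_sq (w : ι → ℝ) (hw1 : ∑ i, w i = 1) (x : ι → H) :
    ∑ i, w i * ‖x i - ∑ j, w j • x j‖ ^ 2 = ∑ i, w i * ‖x i‖ ^ 2 - ‖∑ j, w j • x j‖ ^ 2 := by
  set m := ∑ j, w j • x j with hm
  have h : ∀ i, w i * ‖x i - m‖ ^ 2
      = w i * ‖x i‖ ^ 2 - 2 * inner ℝ (w i • x i) m + w i * ‖m‖ ^ 2 := by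
    intro i
    rw [norm_sub_sq_real, real_inner_smul_left]
    ring
  simp_rw [h]
  rw [Finset.sum_add_distrib, Finset.sum_sub_distrib, ← Finset.mul_sum, ← sum_inner, ← hm,
    ← Finset.sum_mul, hw1, real_inner_self_eq_norm_sq]
  ring

theorem norm_le_wnorm {w : ι → ℝ} (hw : ∀ i, 0 ≤ w i) (x : ι → H) (i : ι) :
    √(w i) * ‖x i‖ ≤ wnorm w x := by
  refine abs_le_of_sq_le_sq' ?_ (wnorm_nonneg _ _) |>.2
  rw [wnorm_sq hw, mul_pow, Real.sq_sqrt (hw i)]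
  exact Finset.single_le_sum (f := fun i => w i * ‖x i‖ ^ 2)
    (fun j _ => mul_nonneg (hw j) (sq_nonneg _)) (Finset.mem_univ i)

/-- A quadratic form given by a positive semidefinite matrix is nonnegative on families of vectors
of a Hilbert space. -/
theorem sum_inner_nonneg_of_posSemidef {Q : Matrix ι ι ℝ} (hQ : Q.PosSemidef) (x : ι → H) :
    0 ≤ ∑ j, ∑ k, Q j k * inner ℝ (x j) (x k) := by
  -- Writing `Q` as a sum of rank-one matrices `v vᵀ` turns the form into a sum of squared norms,
  -- whatever the space of values.
  obtain ⟨m, v, rfl⟩ := Matrix.posSemidef_iff_eq_sum_vecMulVec.mp hQ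
  have : ∑ j, ∑ k, (∑ l, Matrix.vecMulVec (v l) (star (v l))) j k * inner ℝ (x j) (x k)
      = ∑ l, ‖∑ j, v l j • x j‖ ^ 2 := by
    simp_rw [Matrix.sum_apply, Finset.sum_mul]
    rw [Finset.sum_congr rfl fun j _ => Finset.sum_comm, Finset.sum_comm]
    refine Finset.sum_congr rfl fun l _ => ?_
    rw [← real_inner_self_eq_norm_sq, sum_inner]
    refine Finset.sum_congr rfl fun j _ => ?_
    rw [inner_sum]
    refine Finset.sum_congr rfl fun k _ => ?_
    rw [real_inner_smul_left, real_inner_smul_right, Matrix.vecMulVec_apply, Pi.star_apply,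
      star_trivial]
    ring
  rw [this]
  positivity

theorem sum_weight_norm_sq_eq (w : ι → ℝ) (M : Matrix ι ι ℝ) (x : ι → H) :
    ∑ i, w i * ‖∑ j, M i j • x j‖ ^ 2
      = ∑ j, ∑ k, (∑ i, w i * M i j * M i k) * inner ℝ (x j) (x k) := by
  simp_rw [Finset.sum_mul]
  rw [Finset.sum_congr rfl fun j _ => Finset.sum_comm, Finset.sum_comm]
  refine Finset.sum_congr rfl fun i _ => ?_
  rw [← real_inner_self_eq_norm_sq, sum_inner, Finset.mul_sum]
  refine Finset.sum_congr rfl fun j _ => ?_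
  rw [inner_sum, Finset.mul_sum]
  refine Finset.sum_congr rfl fun k _ => ?_
  rw [real_inner_smul_left, real_inner_smul_right]
  ring

theorem sum_weight_norm_sq_eq_diagonal [DecidableEq ι] (w : ι → ℝ) (x : ι → H) :
    ∑ i, w i * ‖x i‖ ^ 2
      = ∑ j, ∑ k, (Matrix.diagonal w : Matrix ι ι ℝ) j k * inner ℝ (x j) (x k) := by
  refine Finset.sum_congr rfl fun i _ => ?_
  rw [Finset.sum_eq_single i (fun k _ hk => by rw [Matrix.diagonal_apply_ne' _ hk, zero_mul])
    (by simp), Matrix.diagonal_apply_eq, real_inner_self_eq_norm_sq]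

/-- The quadratic form measuring the defect in a weighted norm bound for the matrix `M`. -/
def defectForm [DecidableEq ι] (w w' : ι → ℝ) (M : Matrix ι ι ℝ) (c : ℝ) : Matrix ι ι ℝ :=
  Matrix.of fun j k =>
    c ^ 2 * (Matrix.diagonal w' : Matrix ι ι ℝ) j k - ∑ i, w i * M i j * M i k

theorem sum_defectForm [DecidableEq ι] (w w' : ι → ℝ) (M : Matrix ι ι ℝ) (c : ℝ) (x : ι → H) :
    ∑ j, ∑ k, defectForm w w' M c j k * inner ℝ (x j) (x k)
      = c ^ 2 * ∑ i, w' i * ‖x i‖ ^ 2 - ∑ i, w i * ‖∑ j, M i j • x j‖ ^ 2 := by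
  rw [sum_weight_norm_sq_eq, sum_weight_norm_sq_eq_diagonal, Finset.mul_sum,
    ← Finset.sum_sub_distrib]
  refine Finset.sum_congr rfl fun j _ => ?_
  rw [Finset.mul_sum, ← Finset.sum_sub_distrib]
  refine Finset.sum_congr rfl fun k _ => ?_
  simp only [defectForm, Matrix.of_apply]
  ring

/-- A weighted norm bound for a real matrix carries over to families of vectors of a
Hilbert space. -/
theorem wnorm_matrix_le {w w' : ι → ℝ} (hw : ∀ i, 0 ≤ w i) (hw' : ∀ i, 0 ≤ w' i)
    {M : Matrix ι ι ℝ} {c : ℝ} (hc : 0 ≤ c)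
    (hM : ∀ x : ι → ℝ, wnorm w (M *ᵥ x) ≤ c * wnorm w' x) (x : ι → H) :
    wnorm w (fun i => ∑ j, M i j • x j) ≤ c * wnorm w' x := by
  classical
  -- The bound on real vectors says exactly that this form is positive semidefinite, a property of
  -- the matrix that no longer refers to real vectors.
  have hQ : (defectForm w w' M c).PosSemidef := by
    refine Matrix.PosSemidef.of_dotProduct_mulVec_nonneg ?_ fun x => ?_
    · ext j k
      simp only [Matrix.conjTranspose_apply, star_trivial, defectForm, Matrix.of_apply]
      congr 1
      · rw [← Matrix.diagonal_transpose, Matrix.transpose_apply, Matrix.diagonal_transpose]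
      · exact Finset.sum_congr rfl fun i _ => by ring
    · have h1 : star x ⬝ᵥ (defectForm w w' M c *ᵥ x)
          = ∑ j, ∑ k, defectForm w w' M c j k * inner ℝ (x j) (x k) := by
        simp only [dotProduct, Matrix.mulVec, Pi.star_apply, star_trivial, Finset.mul_sum]
        refine Finset.sum_congr rfl fun j _ => Finset.sum_congr rfl fun k _ => ?_
        simp only [RCLike.inner_apply, conj_trivial]
        ring
      rw [h1, sum_defectForm, sub_nonneg, ← wnorm_sq hw', ← mul_pow]
      have h2 := wnorm_sq hw (M *ᵥ x)
      simp only [Matrix.mulVec, dotProduct] at h2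
      simp only [smul_eq_mul]
      rw [← h2]
      exact pow_le_pow_left₀ (wnorm_nonneg _ _) (hM x) 2
  refine wnorm_le_of_sq_le hw hw' hc ?_
  have := sum_inner_nonneg_of_posSemidef hQ x
  rw [sum_defectForm] at this
  linarith

/-- Jensen's inequality for the squared norm. -/
theorem norm_weighted_sum_le {w : ι → ℝ} (hw : ∀ i, 0 ≤ w i) (hw1 : ∑ i, w i = 1)
    (x : ι → H) : ‖∑ i, w i • x i‖ ≤ wnorm w x := by
  refine abs_le_of_sq_le_sq' ?_ (wnorm_nonneg _ _) |>.2
  have := sum_weight_norm_sub_sq w hw1 x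
  rw [wnorm_sq hw]
  have h0 : 0 ≤ ∑ i, w i * ‖x i - ∑ j, w j • x j‖ ^ 2 :=
    Finset.sum_nonneg fun i _ => mul_nonneg (hw i) (sq_nonneg _)
  linarith

/-- Subtracting the weighted mean does not increase the weighted norm. -/
theorem wnorm_sub_mean_le {w : ι → ℝ} (hw : ∀ i, 0 ≤ w i) (hw1 : ∑ i, w i = 1)
    (x : ι → H) : wnorm w (fun i => x i - ∑ j, w j • x j) ≤ wnorm w x := by
  rw [← one_mul (wnorm w x)]
  refine wnorm_le_of_sq_le hw hw zero_le_one ?_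
  rw [sum_weight_norm_sub_sq w hw1 x]
  nlinarith [sq_nonneg ‖∑ j, w j • x j‖]

end WeightedNorm

/-! ### Spectral gaps of the communication matrices -/

section Contraction

variable {N : ℕ}

theorem weightedNorm_eq_wnorm {w : Fin N → ℝ} (hw : ∀ i, 0 ≤ w i) (x : Fin N → ℝ) :
    weightedNorm w x = wnorm w x := by
  unfold weightedNorm
  rw [← Real.sqrt_sq (wnorm_nonneg w x), wnorm_sq hw]
  simp only [Real.norm_eq_abs, sq_abs]

theorem inducedNorm_le {p : (Fin N → ℝ) → ℝ} {M : Matrix (Fin N) (Fin N) ℝ} {c : ℝ}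
    (hc : 0 ≤ c) (h : ∀ x, p (M *ᵥ x) ≤ c * p x) : inducedNorm p M ≤ c :=
  csInf_le ⟨0, fun _ hb => hb.1⟩ ⟨hc, h⟩

theorem inducedNorm_nonneg (p : (Fin N → ℝ) → ℝ) (M : Matrix (Fin N) (Fin N) ℝ) :
    0 ≤ inducedNorm p M :=
  Real.sInf_nonneg fun _ hb => hb.1

/-- Some admissible `c` is required: the infimum of an empty set would be the default value 0. -/
theorem le_inducedNorm {p : (Fin N → ℝ) → ℝ} (hp : ∀ x, 0 ≤ p x)
    {M : Matrix (Fin N) (Fin N) ℝ} {c : ℝ}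
    (hc : 0 ≤ c) (h : ∀ x, p (M *ᵥ x) ≤ c * p x) (x : Fin N → ℝ) :
    p (M *ᵥ x) ≤ inducedNorm p M * p x := by
  rcases (hp x).eq_or_lt with h0 | h0
  · have := h x
    rw [← h0, mul_zero] at this ⊢
    exact this
  · rw [← div_le_iff₀ h0]
    exact le_csInf ⟨c, hc, h⟩ fun b hb => (div_le_iff₀ h0).2 (hb.2 x)

theorem eq_of_isConsistent {G : Digraph (Fin N)} (hG : IsStronglyConnected G)
    {A : Matrix (Fin N) (Fin N) ℝ} (hGA : IsConsistent G A) {x : Fin N → ℝ}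
    (hx : ∀ i j, 0 < A i j → x i = x j) (i j : Fin N) : x i = x j := by
  induction hG i j with
  | refl => rfl
  | @tail b c _ hbc ih =>
    rw [ih]
    -- The graph may have loops, on which `IsConsistent` says nothing.
    by_cases h : c = b
    · rw [h]
    · exact (hx c b ((hGA.2 c b h).2 hbc)).symm

theorem sum_weight_mulVec {A : Matrix (Fin N) (Fin N) ℝ} {π : Fin N → ℝ} (hπA : π ᵥ* A = π)
    (f : Fin N → ℝ) : ∑ i, π i * ∑ j, A i j * f j = ∑ j, π j * f j := by
  simp_rw [Finset.mul_sum]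
  rw [Finset.sum_comm]
  refine Finset.sum_congr rfl fun j _ => ?_
  have := congrFun hπA j
  simp only [Matrix.vecMul, dotProduct] at this
  rw [← this, Finset.sum_mul]
  exact Finset.sum_congr rfl fun i _ => by ring

/-- A row-stochastic matrix decreases the `π`-weighted norm by exactly the averaged variance. -/
theorem sum_weight_mulVec_sq {A : Matrix (Fin N) (Fin N) ℝ}
    (hA : A ∈ Matrix.rowStochastic ℝ (Fin N)) {π : Fin N → ℝ} (hπA : π ᵥ* A = π)
    (x : Fin N → ℝ) :
    ∑ i, π i * ∑ j, A i j * (x j - (A *ᵥ x) i) ^ 2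
      = ∑ i, π i * x i ^ 2 - ∑ i, π i * (A *ᵥ x) i ^ 2 := by
  have h : ∀ i, ∑ j, A i j * (x j - (A *ᵥ x) i) ^ 2
      = ∑ j, A i j * x j ^ 2 - (A *ᵥ x) i ^ 2 := by
    intro i
    have := sum_weight_norm_sub_sq (A i) (Matrix.sum_row_of_mem_rowStochastic hA i) x
    simp only [Real.norm_eq_abs, sq_abs, smul_eq_mul] at this
    exact this
  simp_rw [h, mul_sub]
  rw [Finset.sum_sub_distrib, sum_weight_mulVec hπA]

/-- Without strict decrease, all row variances vanish, so `x j = (A x) i` whenever `A i j > 0`. The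
positive diagonal identifies this value with `x i`, connectivity makes `x` constant, and mean zero
makes it zero. -/
theorem wnorm_mulVec_lt {G : Digraph (Fin N)} (hG : IsStronglyConnected G)
    {A : Matrix (Fin N) (Fin N) ℝ} (hGA : IsConsistent G A)
    (hA : A ∈ Matrix.rowStochastic ℝ (Fin N)) {π : Fin N → ℝ} (hπ : ∀ i, 0 < π i)
    (hπA : π ᵥ* A = π) {x : Fin N → ℝ} (hx : ∑ i, π i * x i = 0) (hx0 : 0 < wnorm π x) :
    wnorm π (A *ᵥ x) < wnorm π x := by
  by_contra! hle
  have hsq := pow_le_pow_left₀ (wnorm_nonneg π x) hle 2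
  rw [wnorm_sq fun i => (hπ i).le, wnorm_sq fun i => (hπ i).le] at hsq
  simp only [Real.norm_eq_abs, sq_abs] at hsq
  have hid := sum_weight_mulVec_sq hA hπA x
  have hA0 : ∀ i j, 0 ≤ A i j := hA.1
  have hin : ∀ i, 0 ≤ ∑ j, A i j * (x j - (A *ᵥ x) i) ^ 2 := fun i =>
    Finset.sum_nonneg fun j _ => mul_nonneg (hA0 i j) (sq_nonneg _)
  have hz : ∑ i, π i * ∑ j, A i j * (x j - (A *ᵥ x) i) ^ 2 = 0 :=
    le_antisymm (by linarith) (Finset.sum_nonneg fun i _ => mul_nonneg (hπ i).le (hin i))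
  have hz' : ∀ i j, 0 < A i j → x j = (A *ᵥ x) i := by
    intro i j hij
    have h1 := (Finset.sum_eq_zero_iff_of_nonneg
      fun i _ => mul_nonneg (hπ i).le (hin i)).1 hz i (Finset.mem_univ i)
    have h2 := (mul_eq_zero.1 h1).resolve_left (hπ i).ne'
    have h3 := (Finset.sum_eq_zero_iff_of_nonneg
      fun j _ => mul_nonneg (hA0 i j) (sq_nonneg _)).1 h2 j (Finset.mem_univ j)
    have h4 := (mul_eq_zero.1 h3).resolve_left hij.ne'
    exact sub_eq_zero.1 (pow_eq_zero_iff two_ne_zero |>.1 h4)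
  have hconst := eq_of_isConsistent hG hGA (x := x)
    fun i j hij => (hz' i i (hGA.1 i)).trans (hz' i j hij).symm
  have hxz : x = 0 := by
    funext i
    have h1 : (∑ j, π j) * x i = 0 := by
      rw [Finset.sum_mul, ← hx]
      exact Finset.sum_congr rfl fun j _ => by rw [hconst i j]
    have : 0 < ∑ j, π j := Finset.sum_pos (fun j _ => hπ j) ⟨i, Finset.mem_univ i⟩
    exact (mul_eq_zero.1 h1).resolve_left this.ne'
  rw [hxz, wnorm_zero] at hx0
  exact lt_irrefl _ hx0

theorem continuous_wnorm (w : Fin N → ℝ) : Continuous fun x : Fin N → ℝ => wnorm w x := by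
  unfold wnorm
  fun_prop

/-- The strict decrease becomes a uniform factor by compactness of the unit sphere of the mean-zero
hyperplane. -/
theorem exists_contraction_of_sum_eq_zero {G : Digraph (Fin N)} (hG : IsStronglyConnected G)
    {A : Matrix (Fin N) (Fin N) ℝ} (hGA : IsConsistent G A)
    (hA : A ∈ Matrix.rowStochastic ℝ (Fin N)) {π : Fin N → ℝ} (hπ : ∀ i, 0 < π i)
    (hπA : π ᵥ* A = π) :
    ∃ σ, 0 ≤ σ ∧ σ < 1 ∧ ∀ x : Fin N → ℝ, ∑ i, π i * x i = 0 →
      wnorm π (A *ᵥ x) ≤ σ * wnorm π x := by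
  let S : Set (Fin N → ℝ) := {x | wnorm π x = 1 ∧ ∑ i, π i * x i = 0}
  have hS : IsCompact S := by
    refine IsCompact.of_isClosed_subset
      (isCompact_univ_pi fun i => isCompact_Icc (a := -(√(π i))⁻¹) (b := (√(π i))⁻¹)) ?_ ?_
    · exact (isClosed_eq (continuous_wnorm π) continuous_const).inter
        (isClosed_eq (by fun_prop) continuous_const)
    · intro x hx i _
      have h1 := norm_le_wnorm (fun i => (hπ i).le) x i
      rw [hx.1, mul_comm, ← le_div_iff₀ (Real.sqrt_pos.2 (hπ i)), one_div, Real.norm_eq_abs] at h1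
      exact abs_le.1 h1
  have hnorm : ∀ x : Fin N → ℝ, ∑ i, π i * x i = 0 → 0 < wnorm π x →
      (wnorm π x)⁻¹ • x ∈ S := by
    intro x hx hx0
    constructor
    · have := wnorm_smul π (wnorm π x)⁻¹ x
      rw [abs_of_pos (inv_pos.2 hx0), inv_mul_cancel₀ hx0.ne'] at this
      exact this
    · have : ∑ i, π i * ((wnorm π x)⁻¹ • x) i = (wnorm π x)⁻¹ * ∑ i, π i * x i := by
        rw [Finset.mul_sum]
        exact Finset.sum_congr rfl fun i _ => by simp; ring
      rw [this, hx, mul_zero]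
  have hscale : ∀ x : Fin N → ℝ, 0 < wnorm π x →
      wnorm π (A *ᵥ x) = wnorm π (A *ᵥ ((wnorm π x)⁻¹ • x)) * wnorm π x := by
    intro x hx0
    have := wnorm_smul π (wnorm π x)⁻¹ (A *ᵥ x)
    rw [Matrix.mulVec_smul]
    change _ = wnorm π (fun i => (wnorm π x)⁻¹ • (A *ᵥ x) i) * _
    rw [this, abs_of_pos (inv_pos.2 hx0)]
    field_simp
  have hdeg : ∀ x : Fin N → ℝ, wnorm π x = 0 → wnorm π (A *ᵥ x) = 0 := by
    intro x hx
    have : x = 0 := by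
      funext i
      have h1 := norm_le_wnorm (fun i => (hπ i).le) x i
      rw [hx] at h1
      have h2 : ‖x i‖ ≤ 0 := by
        by_contra! h
        exact absurd h1 (not_le.2 (mul_pos (Real.sqrt_pos.2 (hπ i)) h))
      exact norm_le_zero_iff.1 h2
    rw [this, Matrix.mulVec_zero, wnorm_zero]
  -- The sphere is empty when `N ≤ 1`; then only the zero vector has to be treated.
  rcases S.eq_empty_or_nonempty with hE | hne
  · refine ⟨0, le_rfl, one_pos, fun x hx => ?_⟩
    rcases (wnorm_nonneg π x).eq_or_lt with h0 | h0
    · rw [hdeg x h0.symm, zero_mul]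
    · exact absurd (hnorm x hx h0) (by simp [hE])
  · obtain ⟨x₀, hx₀, hmax⟩ := hS.exists_isMaxOn hne
      (f := fun x => wnorm π (A *ᵥ x))
      ((continuous_wnorm π).comp (by fun_prop)).continuousOn
    refine ⟨wnorm π (A *ᵥ x₀), wnorm_nonneg _ _, ?_, fun x hx => ?_⟩
    · rw [← hx₀.1]
      exact wnorm_mulVec_lt hG hGA hA hπ hπA hx₀.2 (by rw [hx₀.1]; exact one_pos)
    · rcases (wnorm_nonneg π x).eq_or_lt with h0 | h0
      · rw [hdeg x h0.symm, ← h0, mul_zero]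
      · rw [hscale x h0]
        exact mul_le_mul_of_nonneg_right (hmax (hnorm x hx h0)) h0.le

/-- The rank-one matrix all of whose rows are `π`. -/
def rowLimit (π : Fin N → ℝ) : Matrix (Fin N) (Fin N) ℝ := Matrix.of fun _ j => π j

/-- The rank-one matrix all of whose columns are `ν`. -/
def colLimit (ν : Fin N → ℝ) : Matrix (Fin N) (Fin N) ℝ := Matrix.of fun i _ => ν i

/-- Subtracting the limit amounts to centring `x` before applying `A`, and centring does not
increase the norm. -/
theorem exists_contraction_row {G : Digraph (Fin N)} (hG : IsStronglyConnected G)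
    {A : Matrix (Fin N) (Fin N) ℝ} (hGA : IsConsistent G A)
    (hA : A ∈ Matrix.rowStochastic ℝ (Fin N)) {π : Fin N → ℝ} (hπ : ∀ i, 0 < π i)
    (hπ1 : ∑ i, π i = 1) (hπA : π ᵥ* A = π) :
    ∃ σ, 0 ≤ σ ∧ σ < 1 ∧ ∀ x : Fin N → ℝ,
      wnorm π ((A - rowLimit π) *ᵥ x) ≤ σ * wnorm π x := by
  obtain ⟨σ, h0, h1, h⟩ := exists_contraction_of_sum_eq_zero hG hGA hA hπ hπA
  refine ⟨σ, h0, h1, fun x => ?_⟩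
  set m := ∑ j, π j • x j with hm
  have e : (A - rowLimit π) *ᵥ x = A *ᵥ (fun i => x i - m) := by
    funext i
    simp only [Matrix.mulVec, dotProduct, Matrix.sub_apply, rowLimit, Matrix.of_apply, sub_mul,
      mul_sub, Finset.sum_sub_distrib, ← Finset.sum_mul,
      Matrix.sum_row_of_mem_rowStochastic hA i, one_mul, hm, smul_eq_mul]
  rw [e]
  refine (h _ ?_).trans (mul_le_mul_of_nonneg_left
    (wnorm_sub_mean_le (fun i => (hπ i).le) hπ1 x) h0)
  simp only [mul_sub, Finset.sum_sub_distrib, ← Finset.sum_mul, hπ1, one_mul, hm, smul_eq_mul,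
    sub_self]

theorem wnorm_inv_eq {ν : Fin N → ℝ} (hν : ∀ i, 0 < ν i) {H : Type*} [NormedAddCommGroup H]
    [InnerProductSpace ℝ H] (x : Fin N → H) :
    wnorm (fun i => (ν i)⁻¹) x = wnorm ν (fun i => (ν i)⁻¹ • x i) := by
  refine wnorm_eq_of_pointwise (fun i => (inv_pos.2 (hν i)).le) (fun i => (hν i).le) fun i => ?_
  have := (hν i).ne'
  rw [norm_smul, mul_pow, Real.norm_eq_abs, sq_abs]
  field_simp

theorem exists_contraction_col {G : Digraph (Fin N)} (hG : IsStronglyConnected G)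
    {B : Matrix (Fin N) (Fin N) ℝ} (hGB : IsConsistent G B)
    (hB : B ∈ Matrix.colStochastic ℝ (Fin N)) {ν : Fin N → ℝ} (hν : ∀ i, 0 < ν i)
    (hν1 : ∑ i, ν i = 1) (hνB : B *ᵥ ν = ν) :
    ∃ σ, 0 ≤ σ ∧ σ < 1 ∧ ∀ x : Fin N → ℝ,
      wnorm (fun i => (ν i)⁻¹) ((B - colLimit ν) *ᵥ x)
        ≤ σ * wnorm (fun i => (ν i)⁻¹) x := by
  -- The similar matrix `D_ν⁻¹ B D_ν` is row-stochastic, consistent with the same graph, and has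
  -- left eigenvector `ν`; rescaling by `D_ν⁻¹` carries the `ν`-norm to the norm with weights `ν i`.
  let A : Matrix (Fin N) (Fin N) ℝ := Matrix.of fun i j => (ν i)⁻¹ * (B i j * ν j)
  have hBsum : ∀ j, ∑ i, B i j = 1 := (Matrix.mem_colStochastic_iff_sum.1 hB).2
  have hpos : ∀ i j, 0 < A i j ↔ 0 < B i j := fun i j => by
    simp only [A, Matrix.of_apply, inv_pos, hν i, hν j, mul_pos_iff_of_pos_left,
      mul_pos_iff_of_pos_right]
  have hGA : IsConsistent G A :=
    ⟨fun i => (hpos i i).2 (hGB.1 i), fun i j hij => (hpos i j).trans (hGB.2 i j hij)⟩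
  have hA : A ∈ Matrix.rowStochastic ℝ (Fin N) := by
    refine Matrix.mem_rowStochastic_iff_sum.2 ⟨fun i j => ?_, fun i => ?_⟩
    · exact mul_nonneg (inv_pos.2 (hν i)).le (mul_nonneg (hB.1 i j) (hν j).le)
    · have : ∑ j, B i j * ν j = ν i := congrFun hνB i
      simp only [A, Matrix.of_apply]
      rw [← Finset.mul_sum, this, inv_mul_cancel₀ (hν i).ne']
  have hνA : ν ᵥ* A = ν := by
    funext j
    simp only [Matrix.vecMul, dotProduct, A, Matrix.of_apply]
    have : ∀ i, ν i * ((ν i)⁻¹ * (B i j * ν j)) = B i j * ν j := fun i => by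
      rw [← mul_assoc, mul_inv_cancel₀ (hν i).ne', one_mul]
    simp_rw [this]
    rw [← Finset.sum_mul, hBsum, one_mul]
  obtain ⟨σ, h0, h1, h⟩ := exists_contraction_row hG hGA hA hν hν1 hνA
  refine ⟨σ, h0, h1, fun x => ?_⟩
  rw [wnorm_inv_eq hν, wnorm_inv_eq hν]
  convert h (fun i => (ν i)⁻¹ • x i) using 2
  funext i
  simp only [Matrix.mulVec, dotProduct, Matrix.sub_apply, rowLimit, colLimit, A, Matrix.of_apply,
    smul_eq_mul, Finset.mul_sum]
  refine Finset.sum_congr rfl fun j _ => ?_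
  have := (hν j).ne'
  have := (hν i).ne'
  field_simp

theorem tendsto_pow_of_contraction {w : Fin N → ℝ} (hw : ∀ i, 0 < w i)
    {M : Matrix (Fin N) (Fin N) ℝ} {σ : ℝ} (h0 : 0 ≤ σ) (h1 : σ < 1)
    (hM : ∀ x : Fin N → ℝ, wnorm w (M *ᵥ x) ≤ σ * wnorm w x) :
    Tendsto (fun k : ℕ => M ^ k) atTop (𝓝 0) := by
  have hk : ∀ k x, wnorm w ((M ^ k) *ᵥ x) ≤ σ ^ k * wnorm w x := by
    intro k x
    induction k with
    | zero => simp
    | succ k ih =>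
      rw [pow_succ', ← Matrix.mulVec_mulVec, pow_succ', mul_assoc]
      exact (hM _).trans (mul_le_mul_of_nonneg_left ih h0)
  refine tendsto_pi_nhds.2 fun i => tendsto_pi_nhds.2 fun j => ?_
  refine squeeze_zero_norm (a := fun k : ℕ => σ ^ k * (wnorm w (Pi.single j (1 : ℝ)) / √(w i)))
    (fun k => ?_) ?_
  · have := (norm_le_wnorm (fun i => (hw i).le) _ i).trans (hk k (Pi.single j 1))
    rw [Matrix.mulVec_single_one] at this
    rw [← mul_div_assoc, le_div_iff₀' (Real.sqrt_pos.2 (hw i))]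
    exact this
  · simpa using (tendsto_pow_atTop_nhds_zero_of_lt_one h0 h1).mul_const
      (wnorm w (Pi.single j (1 : ℝ)) / √(w i))

theorem infPower_eq_of_contraction {w : Fin N → ℝ} (hw : ∀ i, 0 < w i)
    {A P : Matrix (Fin N) (Fin N) ℝ} (hAP : A * P = P) (hPA : P * A = P) (hPP : P * P = P)
    {σ : ℝ} (h0 : 0 ≤ σ) (h1 : σ < 1)
    (hM : ∀ x : Fin N → ℝ, wnorm w ((A - P) *ᵥ x) ≤ σ * wnorm w x) :
    infPower A = P := by
  -- The identity fails for exponent 0, where the left side is the identity matrix; hence the shift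
  -- by one.
  have hpow : ∀ k : ℕ, (A - P) ^ (k + 1) = A ^ (k + 1) - P := by
    intro k
    have hkP : ∀ k : ℕ, A ^ k * P = P := by
      intro k
      induction k with
      | zero => simp
      | succ k ih => rw [pow_succ, mul_assoc, hAP, ih]
    induction k with
    | zero => simp
    | succ k ih =>
      rw [pow_succ, ih, sub_mul, mul_sub, mul_sub, hkP, hPA, hPP, sub_self, sub_zero, ← pow_succ]
  have ht := (tendsto_add_atTop_iff_nat 1).2 (tendsto_pow_of_contraction hw h0 h1 hM)
  simp_rw [hpow] at ht
  have ht' : Tendsto (fun k : ℕ => A ^ (k + 1)) atTop (𝓝 P) := by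
    simpa using ht.add_const P
  exact ((tendsto_add_atTop_iff_nat 1).1 ht').limUnder_eq

theorem infPower_row {G : Digraph (Fin N)} (hG : IsStronglyConnected G)
    {A : Matrix (Fin N) (Fin N) ℝ} (hGA : IsConsistent G A)
    (hA : A ∈ Matrix.rowStochastic ℝ (Fin N)) {π : Fin N → ℝ} (hπ : ∀ i, 0 < π i)
    (hπ1 : ∑ i, π i = 1) (hπA : π ᵥ* A = π) : infPower A = rowLimit π := by
  obtain ⟨σ, h0, h1, h⟩ := exists_contraction_row hG hGA hA hπ hπ1 hπA
  refine infPower_eq_of_contraction hπ ?_ ?_ ?_ h0 h1 h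
  · ext i j
    simp [Matrix.mul_apply, rowLimit, ← Finset.sum_mul, Matrix.sum_row_of_mem_rowStochastic hA i]
  · ext i j
    simpa [Matrix.mul_apply, rowLimit, Matrix.vecMul, dotProduct] using congrFun hπA j
  · ext i j
    simp [Matrix.mul_apply, rowLimit, ← Finset.sum_mul, hπ1]

theorem infPower_col {G : Digraph (Fin N)} (hG : IsStronglyConnected G)
    {B : Matrix (Fin N) (Fin N) ℝ} (hGB : IsConsistent G B)
    (hB : B ∈ Matrix.colStochastic ℝ (Fin N)) {ν : Fin N → ℝ} (hν : ∀ i, 0 < ν i)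
    (hν1 : ∑ i, ν i = 1) (hνB : B *ᵥ ν = ν) : infPower B = colLimit ν := by
  obtain ⟨σ, h0, h1, h⟩ := exists_contraction_col hG hGB hB hν hν1 hνB
  refine infPower_eq_of_contraction (fun i => inv_pos.2 (hν i)) ?_ ?_ ?_ h0 h1 h
  · ext i j
    simpa [Matrix.mul_apply, colLimit, Matrix.mulVec, dotProduct] using congrFun hνB i
  · ext i j
    simp [Matrix.mul_apply, colLimit, ← Finset.mul_sum,
      (Matrix.mem_colStochastic_iff_sum.1 hB).2 j]
  · ext i j
    simp [Matrix.mul_apply, colLimit, ← Finset.mul_sum, hν1]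

/-- The spectral gap of `A` in the `π`-norm, for real vectors and for families in a
Hilbert space. -/
theorem rho₁_spec {G : Digraph (Fin N)} (hG : IsStronglyConnected G)
    {A : Matrix (Fin N) (Fin N) ℝ} (hGA : IsConsistent G A)
    (hA : A ∈ Matrix.rowStochastic ℝ (Fin N)) {π : Fin N → ℝ} (hπ : ∀ i, 0 < π i)
    (hπ1 : ∑ i, π i = 1) (hπA : π ᵥ* A = π) :
    0 ≤ rho₁ A π ∧ rho₁ A π < 1 ∧ ∀ x : Fin N → ℝ,
      wnorm π ((A - rowLimit π) *ᵥ x) ≤ rho₁ A π * wnorm π x := by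
  obtain ⟨σ, h0, h1, h⟩ := exists_contraction_row hG hGA hA hπ hπ1 hπA
  have e : ∀ x, normPi π x = wnorm π x := weightedNorm_eq_wnorm fun i => (hπ i).le
  have h' : ∀ x, normPi π ((A - rowLimit π) *ᵥ x) ≤ σ * normPi π x := fun x => by
    rw [e, e]; exact h x
  unfold rho₁
  rw [infPower_row hG hGA hA hπ hπ1 hπA]
  refine ⟨inducedNorm_nonneg _ _, (inducedNorm_le h0 h').trans_lt h1, fun x => ?_⟩
  rw [← e, ← e]
  exact le_inducedNorm (fun x => by rw [e]; exact wnorm_nonneg _ _) h0 h' x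

/-- The spectral gap of `B` in the `ν`-norm. -/
theorem rho₂_spec {G : Digraph (Fin N)} (hG : IsStronglyConnected G)
    {B : Matrix (Fin N) (Fin N) ℝ} (hGB : IsConsistent G B)
    (hB : B ∈ Matrix.colStochastic ℝ (Fin N)) {ν : Fin N → ℝ} (hν : ∀ i, 0 < ν i)
    (hν1 : ∑ i, ν i = 1) (hνB : B *ᵥ ν = ν) :
    0 ≤ rho₂ B ν ∧ rho₂ B ν < 1 ∧ ∀ x : Fin N → ℝ,
      wnorm (fun i => (ν i)⁻¹) ((B - colLimit ν) *ᵥ x)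
        ≤ rho₂ B ν * wnorm (fun i => (ν i)⁻¹) x := by
  obtain ⟨σ, h0, h1, h⟩ := exists_contraction_col hG hGB hB hν hν1 hνB
  have e : ∀ x, normNu ν x = wnorm (fun i => (ν i)⁻¹) x :=
    weightedNorm_eq_wnorm fun i => (inv_pos.2 (hν i)).le
  have h' : ∀ x, normNu ν ((B - colLimit ν) *ᵥ x) ≤ σ * normNu ν x := fun x => by
    rw [e, e]; exact h x
  unfold rho₂
  rw [infPower_col hG hGB hB hν hν1 hνB]
  refine ⟨inducedNorm_nonneg _ _, (inducedNorm_le h0 h').trans_lt h1, fun x => ?_⟩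
  rw [← e, ← e]
  exact le_inducedNorm (fun x => by rw [e]; exact wnorm_nonneg _ _) h0 h' x

end Contraction

/-! ### The smallest root and the three-dimensional comparison system -/

section Scalar

theorem exists_isLeast_root {q : ℝ → ℝ} (hq : Continuous q) (h0 : 0 < q 0) {b : ℝ} (hb : 0 < b)
    (hqb : q b < 0) :
    ∃ c, IsLeast {a : ℝ | 0 < a ∧ q a = 0} c ∧ ∀ a, 0 < a → a < c → 0 < q a := by
  have hroot : ∀ a, 0 < a → q a ≤ 0 → ∃ c, 0 < c ∧ c ≤ a ∧ q c = 0 := by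
    intro a ha hqa
    obtain ⟨c, hc, hc0⟩ := intermediate_value_Icc' ha.le hq.continuousOn ⟨hqa, h0.le⟩
    refine ⟨c, lt_of_le_of_ne hc.1 ?_, hc.2, hc0⟩
    rintro rfl
    exact h0.ne' hc0
  -- As `q 0 ≠ 0`, the strict inequality may be relaxed, which shows that the set of positive roots
  -- is closed.
  have hS : {a : ℝ | 0 < a ∧ q a = 0} = {a : ℝ | 0 ≤ a ∧ q a = 0} := by
    ext a
    refine ⟨fun h => ⟨h.1.le, h.2⟩, fun h => ⟨lt_of_le_of_ne h.1 ?_, h.2⟩⟩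
    rintro rfl
    exact h0.ne' h.2
  have hcl : IsClosed {a : ℝ | 0 < a ∧ q a = 0} := by
    rw [hS]
    exact (isClosed_le continuous_const continuous_id).inter (isClosed_eq hq continuous_const)
  obtain ⟨c, hc0, -, hqc⟩ := hroot b hb hqb.le
  have hbdd : BddBelow {a : ℝ | 0 < a ∧ q a = 0} := ⟨0, fun a ha => ha.1.le⟩
  refine ⟨_, ⟨hcl.csInf_mem ⟨c, hc0, hqc⟩ hbdd, fun a ha => csInf_le hbdd ha⟩, fun a ha hac => ?_⟩
  by_contra! hqa
  obtain ⟨c', hc'0, hc'a, hqc'⟩ := hroot a ha hqa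
  exact absurd (csInf_le hbdd ⟨hc'0, hqc'⟩) (not_le.2 (hc'a.trans_lt hac))

/-- If `I - M` is a `Z`-matrix of size three with positive determinant and the first pivot
positive, then `M` contracts some positive vector. -/
theorem exists_positive_contracted_vector {m₁₁ m₁₂ m₂₁ m₂₂ m₂₃ m₃₁ m₃₂ e : ℝ}
    (h11 : m₁₁ < 1) (h12 : 0 ≤ m₁₂) (h21 : 0 ≤ m₂₁) (h23 : 0 ≤ m₂₃)
    (h31 : 0 ≤ m₃₁) (h32 : 0 ≤ m₃₂) (he : 0 < e)
    (hdet : 0 < (1 - m₁₁) * ((1 - m₂₂) * e - m₂₃ * m₃₂) - m₁₂ * (m₂₁ * e + m₂₃ * m₃₁)) :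
    ∃ r v₁ v₂ v₃ : ℝ, 0 < r ∧ r < 1 ∧ 0 < v₁ ∧ 0 < v₂ ∧ 0 < v₃ ∧
      m₁₁ * v₁ + m₁₂ * v₂ ≤ r * v₁ ∧ m₂₁ * v₁ + m₂₂ * v₂ + m₂₃ * v₃ ≤ r * v₂ ∧
      m₃₁ * v₁ + m₃₂ * v₂ + (1 - e) * v₃ ≤ r * v₃ := by
  set D := (1 - m₁₁) * ((1 - m₂₂) * e - m₂₃ * m₃₂) - m₁₂ * (m₂₁ * e + m₂₃ * m₃₁) with hD
  have hp : 0 < 1 - m₁₁ := by linarith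
  have hX : 0 < (1 - m₂₂) * e - m₂₃ * m₃₂ := by
    have : 0 < (1 - m₁₁) * ((1 - m₂₂) * e - m₂₃ * m₃₂) := by
      have : 0 ≤ m₁₂ * (m₂₁ * e + m₂₃ * m₃₁) := by positivity
      linarith
    exact (mul_pos_iff_of_pos_left hp).1 this
  have h22 : 0 < 1 - m₂₂ := by
    have : 0 < (1 - m₂₂) * e := by
      have : 0 ≤ m₂₃ * m₃₂ := by positivity
      linarith
    exact (mul_pos_iff_of_pos_right he).1 this
  have hY : 0 < (1 - m₁₁) * (1 - m₂₂) - m₁₂ * m₂₁ := by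
    have : 0 < ((1 - m₁₁) * (1 - m₂₂) - m₁₂ * m₂₁) * e := by
      have h1 : 0 ≤ (1 - m₁₁) * (m₂₃ * m₃₂) := by positivity
      have h2 : 0 ≤ m₁₂ * (m₂₃ * m₃₁) := by positivity
      have h3 : ((1 - m₁₁) * (1 - m₂₂) - m₁₂ * m₂₁) * e
        = D + (1 - m₁₁) * (m₂₃ * m₃₂) + m₁₂ * (m₂₃ * m₃₁) := by rw [hD]; ring
      linarith
    exact (mul_pos_iff_of_pos_right he).1 this
  -- The vector `v` is the adjugate of `I - M` applied to `(1, 1, 1)`, so `(I - M) v = D (1, 1, 1)`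
  -- with `D` the determinant. Its entries are positive because the minors above are.
  obtain ⟨v₁, hv₁⟩ : ∃ v, v = ((1 - m₂₂) * e - m₂₃ * m₃₂) + m₁₂ * e + m₁₂ * m₂₃ := ⟨_, rfl⟩
  obtain ⟨v₂, hv₂⟩ : ∃ v, v = (m₂₁ * e + m₂₃ * m₃₁) + (1 - m₁₁) * e + (1 - m₁₁) * m₂₃ := ⟨_, rfl⟩
  obtain ⟨v₃, hv₃⟩ : ∃ v, v = (m₂₁ * m₃₂ + (1 - m₂₂) * m₃₁) + ((1 - m₁₁) * m₃₂ + m₁₂ * m₃₁)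
      + ((1 - m₁₁) * (1 - m₂₂) - m₁₂ * m₂₁) := ⟨_, rfl⟩
  have p1 : 0 < v₁ := by rw [hv₁]; positivity
  have p2 : 0 < v₂ := by rw [hv₂]; positivity
  have p3 : 0 < v₃ := by rw [hv₃]; positivity
  have e1 : m₁₁ * v₁ + m₁₂ * v₂ = v₁ - D := by rw [hv₁, hv₂, hD]; ring
  have e2 : m₂₁ * v₁ + m₂₂ * v₂ + m₂₃ * v₃ = v₂ - D := by rw [hv₁, hv₂, hv₃, hD]; ring
  have e3 : m₃₁ * v₁ + m₃₂ * v₂ + (1 - e) * v₃ = v₃ - D := by rw [hv₁, hv₂, hv₃, hD]; ring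
  -- Each coordinate is at most the sum of the three, so a single rate serves for all; the maximum
  -- with `1 / 2` keeps it positive.
  have hr : ∀ v, 0 < v → v ≤ v₁ + v₂ + v₃ →
      v - D ≤ max (1 / 2) (1 - D / (v₁ + v₂ + v₃)) * v := by
    intro v hv hle
    refine le_trans ?_ (mul_le_mul_of_nonneg_right (le_max_right _ _) hv.le)
    have h1 : D / (v₁ + v₂ + v₃) * v ≤ D := by
      rw [div_mul_eq_mul_div, div_le_iff₀ (by positivity)]
      exact mul_le_mul_of_nonneg_left hle hdet.le
    linarith
  refine ⟨max (1 / 2) (1 - D / (v₁ + v₂ + v₃)), v₁, v₂, v₃, ?_, ?_, p1, p2, p3, ?_, ?_, ?_⟩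
  · exact lt_max_of_lt_left (by norm_num)
  · refine max_lt (by norm_num) ?_
    have : 0 < D / (v₁ + v₂ + v₃) := by positivity
    linarith
  · rw [e1]; exact hr v₁ p1 (by linarith)
  · rw [e2]; exact hr v₂ p2 (by linarith)
  · rw [e3]; exact hr v₃ p3 (by linarith)

/-- A linear system of three inequalities whose matrix contracts a positive vector forces
geometric decay. -/
theorem exists_geometric_bound {m₁₁ m₁₂ m₂₁ m₂₂ m₂₃ m₃₁ m₃₂ m₃₃ r v₁ v₂ v₃ : ℝ}
    (h11 : 0 ≤ m₁₁) (h12 : 0 ≤ m₁₂) (h21 : 0 ≤ m₂₁) (h22 : 0 ≤ m₂₂) (h23 : 0 ≤ m₂₃)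
    (h31 : 0 ≤ m₃₁) (h32 : 0 ≤ m₃₂) (hr : 0 < r) (hv₁ : 0 < v₁) (hv₂ : 0 < v₂) (hv₃ : 0 < v₃)
    (c1 : m₁₁ * v₁ + m₁₂ * v₂ ≤ r * v₁)
    (c2 : m₂₁ * v₁ + m₂₂ * v₂ + m₂₃ * v₃ ≤ r * v₂)
    (c3 : m₃₁ * v₁ + m₃₂ * v₂ + m₃₃ * v₃ ≤ r * v₃)
    {a b d : ℕ → ℝ}
    (s1 : ∀ k, a (k + 1) ≤ m₁₁ * a k + m₁₂ * b k)
    (s2 : ∀ k, b (k + 1) ≤ m₂₁ * a k + m₂₂ * b k + m₂₃ * d k)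
    (s3 : ∀ k, d (k + 1) ≤ m₃₁ * a k + m₃₂ * b k + m₃₃ * d k)
    (hd : 0 ≤ m₃₃ ∨ ∀ k, d k = 0) :
    ∃ C, 0 ≤ C ∧ ∀ k, a k ≤ C * r ^ k ∧ b k ≤ C * r ^ k ∧ d k ≤ C * r ^ k := by
  obtain ⟨K, hK0, hKa, hKb, hKd⟩ : ∃ K, 0 ≤ K ∧ a 0 ≤ K * v₁ ∧ b 0 ≤ K * v₂ ∧ d 0 ≤ K * v₃ := by
    refine ⟨|a 0| / v₁ + |b 0| / v₂ + |d 0| / v₃, by positivity, ?_, ?_, ?_⟩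
    · rw [← div_le_iff₀ hv₁]
      have h1 : a 0 / v₁ ≤ |a 0| / v₁ := by gcongr; exact le_abs_self _
      have h2 : 0 ≤ |b 0| / v₂ := by positivity
      have h3 : 0 ≤ |d 0| / v₃ := by positivity
      linarith
    · rw [← div_le_iff₀ hv₂]
      have h1 : b 0 / v₂ ≤ |b 0| / v₂ := by gcongr; exact le_abs_self _
      have h2 : 0 ≤ |a 0| / v₁ := by positivity
      have h3 : 0 ≤ |d 0| / v₃ := by positivity
      linarith
    · rw [← div_le_iff₀ hv₃]
      have h1 : d 0 / v₃ ≤ |d 0| / v₃ := by gcongr; exact le_abs_self _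
      have h2 : 0 ≤ |b 0| / v₂ := by positivity
      have h3 : 0 ≤ |a 0| / v₁ := by positivity
      linarith
  have key : ∀ k, a k ≤ K * r ^ k * v₁ ∧ b k ≤ K * r ^ k * v₂ ∧ d k ≤ K * r ^ k * v₃ := by
    intro k
    induction k with
    | zero => simpa using ⟨hKa, hKb, hKd⟩
    | succ k ih =>
      obtain ⟨i1, i2, i3⟩ := ih
      have hT : 0 ≤ K * r ^ k := by positivity
      have hstep : K * r ^ (k + 1) = K * r ^ k * r := by rw [pow_succ]; ring
      rw [hstep]
      set T := K * r ^ k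
      refine ⟨?_, ?_, ?_⟩
      · have q1 := mul_le_mul_of_nonneg_left i1 h11
        have q2 := mul_le_mul_of_nonneg_left i2 h12
        have q := mul_le_mul_of_nonneg_left c1 hT
        linarith [s1 k]
      · have q1 := mul_le_mul_of_nonneg_left i1 h21
        have q2 := mul_le_mul_of_nonneg_left i2 h22
        have q3 := mul_le_mul_of_nonneg_left i3 h23
        have q := mul_le_mul_of_nonneg_left c2 hT
        linarith [s2 k]
      · rcases hd with h33 | h0
        · have q1 := mul_le_mul_of_nonneg_left i1 h31
          have q2 := mul_le_mul_of_nonneg_left i2 h32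
          have q3 := mul_le_mul_of_nonneg_left i3 h33
          have q := mul_le_mul_of_nonneg_left c3 hT
          linarith [s3 k]
        · rw [h0]
          positivity
  refine ⟨K * (v₁ + v₂ + v₃), by positivity, fun k => ?_⟩
  obtain ⟨i1, i2, i3⟩ := key k
  have hT : 0 ≤ K * r ^ k := by positivity
  have w1 := mul_nonneg hT hv₁.le
  have w2 := mul_nonneg hT hv₂.le
  have w3 := mul_nonneg hT hv₃.le
  have e : K * (v₁ + v₂ + v₃) * r ^ k
    = K * r ^ k * v₁ + K * r ^ k * v₂ + K * r ^ k * v₃ := by ring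
  rw [e]
  exact ⟨by linarith, by linarith, by linarith⟩

end Scalar

/-! ### Entrywise consequences of the norm equivalences -/

section NormConstants

variable {N : ℕ}

theorem normE_eq_wnorm (x : Fin N → ℝ) : normE x = wnorm (fun _ => 1) x := by
  unfold normE wnorm
  simp

theorem wnorm_opNormE_le (M : Matrix (Fin N) (Fin N) ℝ) (x : Fin N → ℝ) :
    wnorm (fun _ => 1) (M *ᵥ x) ≤ opNormE M * wnorm (fun _ => 1) x := by
  rw [← normE_eq_wnorm, ← normE_eq_wnorm]
  exact ContinuousLinearMap.le_opNorm (Matrix.toEuclideanCLM (n := Fin N) (𝕜 := ℝ) M)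
    (WithLp.toLp 2 x)

theorem opNormE_nonneg (M : Matrix (Fin N) (Fin N) ℝ) : 0 ≤ opNormE M := norm_nonneg _

theorem normE_single (i : Fin N) : normE (Pi.single i (1 : ℝ)) = 1 := by
  unfold normE
  exact (PiLp.norm_single 2 (fun _ : Fin N => ℝ) i 1).trans (by simp)

theorem inv_le_opNormE_diagonal_inv {ν : Fin N → ℝ} (hν : ∀ i, 0 < ν i) (i : Fin N) :
    (ν i)⁻¹ ≤ opNormE (Matrix.diagonal ν)⁻¹ := by
  have hinv : (Matrix.diagonal ν)⁻¹ = Matrix.diagonal (fun i => (ν i)⁻¹) := by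
    refine Matrix.inv_eq_left_inv ?_
    rw [Matrix.diagonal_mul_diagonal, ← Matrix.diagonal_one]
    congr 1
    funext i
    exact inv_mul_cancel₀ (hν i).ne'
  have h1 := wnorm_opNormE_le (Matrix.diagonal ν)⁻¹ (Pi.single i (1 : ℝ))
  have h2 := norm_le_wnorm (w := fun _ => 1) (fun _ => zero_le_one)
    ((Matrix.diagonal ν)⁻¹ *ᵥ Pi.single i (1 : ℝ)) i
  have h3 : wnorm (fun _ : Fin N => 1) (Pi.single i (1 : ℝ)) = 1 := by
    rw [← normE_eq_wnorm, normE_single]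
  rw [h3, mul_one] at h1
  refine le_trans ?_ (h2.trans h1)
  rw [hinv, Matrix.mulVec_single_one]
  simp [abs_of_pos (hν i)]

theorem weightedNorm_single (w : Fin N → ℝ) (i : Fin N) :
    weightedNorm w (Pi.single i 1) = √(w i) := by
  unfold weightedNorm
  congr 1
  rw [Finset.sum_eq_single i (fun j _ hj => by simp [hj]) (by simp)]
  simp

/-- The norms are diagonal, so testing on basis vectors turns each equivalence into an inequality of
weights, which applies equally to Hilbert space valued families. It also gives positivity of `π`
without Perron–Frobenius theory. -/
theorem NormConstants.sq_le_pi {π ν : Fin N → ℝ} {c₁ c₂ c₃ c₄ : ℝ}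
    (hc : NormConstants π ν c₁ c₂ c₃ c₄) (i : Fin N) : c₁ ^ 2 ≤ π i := by
  have h := hc.lower_pi (Pi.single i 1)
  rw [normE_single, mul_one, normPi, weightedNorm_single] at h
  exact (Real.le_sqrt' hc.pos₁).1 h

theorem NormConstants.pi_pos {π ν : Fin N → ℝ} {c₁ c₂ c₃ c₄ : ℝ}
    (hc : NormConstants π ν c₁ c₂ c₃ c₄) (i : Fin N) : 0 < π i :=
  (pow_pos hc.pos₁ 2).trans_le (hc.sq_le_pi i)

theorem NormConstants.pi_le_sq {π ν : Fin N → ℝ} {c₁ c₂ c₃ c₄ : ℝ}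
    (hc : NormConstants π ν c₁ c₂ c₃ c₄) (i : Fin N) : π i ≤ c₂ ^ 2 := by
  have h := hc.upper_pi (Pi.single i 1)
  rw [normE_single, mul_one, normPi, weightedNorm_single] at h
  exact (Real.sqrt_le_left hc.pos₂.le).1 h

theorem NormConstants.nu_le_pi {π ν : Fin N → ℝ} {c₁ c₂ c₃ c₄ : ℝ}
    (hc : NormConstants π ν c₁ c₂ c₃ c₄) (hν : ∀ i, 0 ≤ ν i) (i : Fin N) :
    c₃ ^ 2 * (ν i)⁻¹ ≤ π i := by
  have h := hc.lower_nu (Pi.single i 1)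
  rw [normPi, normNu, weightedNorm_single, weightedNorm_single] at h
  have := pow_le_pow_left₀ (mul_nonneg hc.pos₃.le (Real.sqrt_nonneg _)) h 2
  rwa [mul_pow, Real.sq_sqrt (inv_nonneg.2 (hν i)), Real.sq_sqrt (hc.pi_pos i).le] at this

theorem NormConstants.pi_le_nu {π ν : Fin N → ℝ} {c₁ c₂ c₃ c₄ : ℝ}
    (hc : NormConstants π ν c₁ c₂ c₃ c₄) (hν : ∀ i, 0 ≤ ν i) (i : Fin N) :
    π i ≤ c₄ ^ 2 * (ν i)⁻¹ := by
  have h := hc.upper_nu (Pi.single i 1)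
  rw [normPi, normNu, weightedNorm_single, weightedNorm_single] at h
  have := pow_le_pow_left₀ (Real.sqrt_nonneg _) h 2
  rwa [mul_pow, Real.sq_sqrt (inv_nonneg.2 (hν i)), Real.sq_sqrt (hc.pi_pos i).le] at this

theorem NormConstants.nu_pos {π ν : Fin N → ℝ} {c₁ c₂ c₃ c₄ : ℝ}
    (hc : NormConstants π ν c₁ c₂ c₃ c₄) (hν : ∀ i, 0 ≤ ν i) (i : Fin N) : 0 < ν i := by
  refine lt_of_le_of_ne (hν i) fun h => ?_
  -- For `ν i = 0` the convention `0⁻¹ = 0` makes this bound read `π i ≤ 0`.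
  have := hc.pi_le_nu hν i
  rw [← h, inv_zero, mul_zero] at this
  exact absurd (hc.pi_pos i) (not_lt.2 this)

/-- Since the entries of `π` sum to one, the largest of them is at least `1 / N`. -/
theorem NormConstants.one_le {π ν : Fin N → ℝ} {c₁ c₂ c₃ c₄ : ℝ}
    (hc : NormConstants π ν c₁ c₂ c₃ c₄) (hπ1 : ∑ i, π i = 1) : 1 ≤ √(N : ℝ) * c₂ := by
  have h : (1 : ℝ) ≤ N * c₂ ^ 2 := by
    rw [← hπ1]
    exact (Finset.sum_le_sum fun i _ => hc.pi_le_sq i).trans (by simp)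
  have h2 : (1 : ℝ) ^ 2 ≤ (√(N : ℝ) * c₂) ^ 2 := by
    rw [mul_pow, Real.sq_sqrt (Nat.cast_nonneg N)]
    linarith
  exact le_of_sq_le_sq h2 (mul_nonneg (Real.sqrt_nonneg _) hc.pos₂.le)

end NormConstants

/-! ### The relaxed operator and the distance to its fixed points -/

section Operator

variable {H : Type*} [NormedAddCommGroup H] [InnerProductSpace ℝ H]

/-- Quasi-nonexpansiveness is equivalent to `2⟨x - p, T x - x⟩ ≤ -‖T x - x‖²`, which bounds the
cross term of the expanded square. -/
theorem norm_relaxation_sq_le {T : H → H} (hT : IsQuasiNonexpansive T) {p : H}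
    (hp : p ∈ Function.fixedPoints T) (x : H) {α : ℝ} (hα : 0 ≤ α) :
    ‖x + α • (T x - x) - p‖ ^ 2 ≤ ‖x - p‖ ^ 2 - α * (1 - α) * ‖T x - x‖ ^ 2 := by
  have h := hT x p hp
  rw [show T p = p from hp, show T x - p = (x - p) + (T x - x) by abel] at h
  have h2 := pow_le_pow_left₀ (norm_nonneg _) h 2
  rw [norm_add_sq_real] at h2
  rw [show x + α • (T x - x) - p = (x - p) + α • (T x - x) by abel, norm_add_sq_real,
    real_inner_smul_right, norm_smul, mul_pow, Real.norm_eq_abs, sq_abs]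
  nlinarith

theorem norm_sub_le_infDist {E : Type*} [NormedAddCommGroup E] {T : E → E} (hT : IsQuasiNonexpansive T)
    (hne : (Function.fixedPoints T).Nonempty) (x : E) :
    ‖T x - x‖ ≤ 2 * Metric.infDist x (Function.fixedPoints T) := by
  rw [← div_le_iff₀' two_pos, Metric.le_infDist hne]
  intro p hp
  rw [div_le_iff₀' two_pos, dist_eq_norm]
  have h := hT x p hp
  rw [show T p = p from hp] at h
  have h2 := norm_sub_le (T x - p) (x - p)
  rw [sub_sub_sub_cancel_right] at h2
  linarith

/-- With `t = δ α / (4 κ²)`, regularity and `δ ≤ 1 - α` make the squared distance drop by at least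
`4 t d²`, and `1 - 4 t ≤ (1 - t)²`. -/
theorem infDist_relaxation_le {T : H → H} (hT : IsQuasiNonexpansive T)
    (hne : (Function.fixedPoints T).Nonempty) {κ : ℝ} (hreg : IsLinearlyRegular T κ)
    (x : H) {α δ : ℝ} (hα : 0 ≤ α) (hδ : 0 ≤ δ) (hαδ : α ≤ 1 - δ) :
    Metric.infDist (x + α • (T x - x)) (Function.fixedPoints T)
      ≤ (1 - δ * α / (4 * κ ^ 2)) * Metric.infDist x (Function.fixedPoints T) := by
  obtain ⟨hκ, hr⟩ := hreg
  set d := Metric.infDist x (Function.fixedPoints T) with hd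
  set D := Metric.infDist (x + α • (T x - x)) (Function.fixedPoints T) with hD
  have hd0 : 0 ≤ d := Metric.infDist_nonneg
  have hD0 : 0 ≤ D := Metric.infDist_nonneg
  have hs : 0 ≤ α * (1 - α) * ‖T x - x‖ ^ 2 :=
    mul_nonneg (mul_nonneg hα (by linarith)) (sq_nonneg _)
  -- No nearest fixed point need exist, so the square root is compared with every `‖x - p‖` before
  -- the infimum is taken.
  have h1 : √(D ^ 2 + α * (1 - α) * ‖T x - x‖ ^ 2) ≤ d := by
    rw [hd, Metric.le_infDist hne]
    intro p hp
    rw [dist_eq_norm]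
    refine Real.sqrt_le_iff.2 ⟨norm_nonneg _, ?_⟩
    have h2 := norm_relaxation_sq_le hT hp x hα
    have h3 : D ≤ ‖x + α • (T x - x) - p‖ := by
      rw [← dist_eq_norm]
      exact Metric.infDist_le_dist_of_mem hp
    have h4 := pow_le_pow_left₀ hD0 h3 2
    linarith
  have h5 : D ^ 2 + α * (1 - α) * ‖T x - x‖ ^ 2 ≤ d ^ 2 := (Real.sqrt_le_left hd0).1 h1
  have h6 : d ^ 2 ≤ κ ^ 2 * ‖T x - x‖ ^ 2 := by
    rw [← mul_pow]
    exact pow_le_pow_left₀ hd0 (hr x) 2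
  -- When `d > 0` this forces `κ ≥ 1 / 2`, hence `t ≤ 1`, as is needed to take square roots.
  have h7 : d ≤ 2 * κ * d := by
    have := norm_sub_le_infDist hT hne x
    have := mul_le_mul_of_nonneg_left this hκ.le
    linarith [hr x]
  have h8 : δ * α / κ ^ 2 * d ^ 2 ≤ α * (1 - α) * ‖T x - x‖ ^ 2 := by
    rw [div_mul_eq_mul_div, div_le_iff₀ (by positivity)]
    have e1 := mul_le_mul_of_nonneg_left h6 (mul_nonneg hδ hα)
    have e2 : 0 ≤ α * (1 - α - δ) * (κ ^ 2 * ‖T x - x‖ ^ 2) :=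
      mul_nonneg (mul_nonneg hα (by linarith)) (by positivity)
    nlinarith
  rcases hd0.eq_or_lt with hz | hpos
  · rw [← hz] at h5 ⊢
    rw [mul_zero]
    nlinarith
  · have hκ2 : 1 / 2 ≤ κ := by
      have : 1 ≤ 2 * κ := by
        by_contra! h
        nlinarith
      linarith
    set t := δ * α / (4 * κ ^ 2) with ht
    have ht4 : δ * α / κ ^ 2 = 4 * t := by rw [ht]; field_simp
    have ht0 : 0 ≤ t := by positivity
    have ht1 : t ≤ 1 := by
      rw [ht, div_le_one (by positivity)]
      nlinarith
    refine le_of_sq_le_sq ?_ (mul_nonneg (by linarith) hd0)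
    rw [ht4] at h8
    have : (1 - t) ^ 2 * d ^ 2 = d ^ 2 - 2 * t * d ^ 2 + t ^ 2 * d ^ 2 := by ring
    rw [mul_pow, this]
    have : 0 ≤ t ^ 2 * d ^ 2 := by positivity
    have : 0 ≤ t * d ^ 2 := by positivity
    linarith

theorem continuous_globalOp {N : ℕ} {F : Fin N → H → H} {L : Fin N → ℝ}
    (hL : ∀ i, IsLipschitz (F i) (L i)) : Continuous (globalOp F) := by
  have : ∀ i, Continuous (F i) := fun i =>
    (LipschitzWith.of_dist_le_mul (K := (L i).toNNReal) fun x y => by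
      rw [dist_eq_norm, dist_eq_norm, Real.coe_toNNReal _ (hL i).1.le]
      exact (hL i).2 x y).continuous
  unfold globalOp
  fun_prop

end Operator

/-! ### One-step estimates for the three errors -/

section Step

variable {N : ℕ} {H : Type*} [NormedAddCommGroup H] [InnerProductSpace ℝ H]

/-- The `π`-weighted mean. -/
def wmean (π : Fin N → ℝ) (x : Fin N → H) : H := ∑ i, π i • x i

/-- The distance to consensus in the `π`-norm. -/
def consensusError (π : Fin N → ℝ) (x : Fin N → H) : ℝ := wnorm π fun i => x i - wmean π x

/-- The distance of `y` to the line spanned by `ν`, in the `ν`-norm. -/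
def trackingError (ν : Fin N → ℝ) (y : Fin N → H) : ℝ :=
  wnorm (fun i => (ν i)⁻¹) fun i => y i - ν i • ∑ j, y j

theorem wmean_add (π : Fin N → ℝ) (x y : Fin N → H) :
    wmean π (fun i => x i + y i) = wmean π x + wmean π y := by
  simp [wmean, Finset.sum_add_distrib]

theorem wmean_smul (π : Fin N → ℝ) (c : ℝ) (x : Fin N → H) :
    wmean π (fun i => c • x i) = c • wmean π x := by
  simp [wmean, Finset.smul_sum, smul_comm c]

theorem wmean_const {π : Fin N → ℝ} (hπ1 : ∑ i, π i = 1) (v : H) :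
    wmean π (fun _ => v) = v := by
  rw [wmean, ← Finset.sum_smul, hπ1, one_smul]

theorem wmean_mulVec {A : Matrix (Fin N) (Fin N) ℝ} {π : Fin N → ℝ} (hπA : π ᵥ* A = π)
    (x : Fin N → H) : wmean π (fun i => ∑ j, A i j • x j) = wmean π x := by
  unfold wmean
  simp_rw [Finset.smul_sum, smul_smul]
  rw [Finset.sum_comm]
  refine Finset.sum_congr rfl fun j _ => ?_
  rw [← Finset.sum_smul]
  congr 1
  exact congrFun hπA j

theorem sub_rowLimit_smul {A : Matrix (Fin N) (Fin N) ℝ}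
    (hA : A ∈ Matrix.rowStochastic ℝ (Fin N)) {π : Fin N → ℝ} (hπ1 : ∑ i, π i = 1)
    (x : Fin N → H) (i : Fin N) :
    ∑ j, (A - rowLimit π) i j • (x j - wmean π x) = ∑ j, A i j • x j - wmean π x := by
  simp only [Matrix.sub_apply, rowLimit, Matrix.of_apply, sub_smul, smul_sub,
    Finset.sum_sub_distrib, ← Finset.sum_smul, Matrix.sum_row_of_mem_rowStochastic hA i, hπ1,
    one_smul]
  simp [wmean]

/-- The rows of `A - 1` sum to zero, so any common vector may be subtracted. -/
theorem sub_one_smul {A : Matrix (Fin N) (Fin N) ℝ}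
    (hA : A ∈ Matrix.rowStochastic ℝ (Fin N)) (x : Fin N → H) (v : H) (i : Fin N) :
    ∑ j, (A - 1) i j • (x j - v) = ∑ j, A i j • x j - x i := by
  have h1 : ∑ j, (1 : Matrix (Fin N) (Fin N) ℝ) i j • x j = x i := by
    rw [Finset.sum_eq_single i (fun j _ hj => by rw [Matrix.one_apply_ne' hj, zero_smul])
      (by simp), Matrix.one_apply_eq, one_smul]
  have h2 : ∑ j, (1 : Matrix (Fin N) (Fin N) ℝ) i j = 1 := by
    simp [Matrix.one_apply]
  simp only [Matrix.sub_apply, sub_smul, smul_sub, Finset.sum_sub_distrib, ← Finset.sum_smul,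
    Matrix.sum_row_of_mem_rowStochastic hA i, h1, h2, one_smul]
  abel

theorem wnorm_row_deviation_le {A : Matrix (Fin N) (Fin N) ℝ}
    (hA : A ∈ Matrix.rowStochastic ℝ (Fin N)) {π : Fin N → ℝ} (hπ : ∀ i, 0 ≤ π i)
    (hπ1 : ∑ i, π i = 1) {ρ : ℝ} (hρ0 : 0 ≤ ρ)
    (hρ : ∀ x : Fin N → ℝ, wnorm π ((A - rowLimit π) *ᵥ x) ≤ ρ * wnorm π x) (x : Fin N → H) :
    wnorm π (fun i => ∑ j, A i j • x j - wmean π x) ≤ ρ * consensusError π x := by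
  have := wnorm_matrix_le hπ hπ hρ0 hρ (fun i => x i - wmean π x)
  simp_rw [sub_rowLimit_smul hA hπ1] at this
  exact this

/-- The rescaled tracking deviation `(1 / (N ν i)) (y i - ν i ∑ y)`. -/
def trackingDeviation (ν : Fin N → ℝ) (y : Fin N → H) (i : Fin N) : H :=
  (1 / (N * ν i)) • (y i - ν i • ∑ j, y j)

theorem wnorm_trackingDeviation_le {π ν : Fin N → ℝ} {c₁ c₂ c₃ c₄ : ℝ}
    (hc : NormConstants π ν c₁ c₂ c₃ c₄) (hν : ∀ i, 0 < ν i) (y : Fin N → H) :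
    wnorm π (trackingDeviation ν y) ≤ theta₁ ν c₄ * trackingError ν y := by
  have hθ : 0 ≤ theta₁ ν c₄ := by
    have := hc.pos₄
    have := opNormE_nonneg (Matrix.diagonal ν)⁻¹
    unfold theta₁
    positivity
  refine wnorm_le_of_pointwise (fun i => (hc.pi_pos i).le) (fun i => (inv_pos.2 (hν i)).le) hθ
    fun i => ?_
  have hN : (0 : ℝ) < N := by
    have := i.pos
    exact_mod_cast this
  have hi := hν i
  rw [trackingDeviation, norm_smul, mul_pow, Real.norm_eq_abs, sq_abs, theta₁,
    ← mul_assoc, ← mul_assoc]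
  refine mul_le_mul_of_nonneg_right ?_ (sq_nonneg _)
  have h1 := hc.pi_le_nu (fun i => (hν i).le) i
  have h2 := pow_le_pow_left₀ (inv_pos.2 hi).le (inv_le_opNormE_diagonal_inv hν i) 2
  calc π i * (1 / (N * ν i)) ^ 2 = π i * ((ν i)⁻¹ ^ 2 / N ^ 2) := by field_simp
    _ ≤ (c₄ ^ 2 * (ν i)⁻¹) * (opNormE (Matrix.diagonal ν)⁻¹ ^ 2 / N ^ 2) := by gcongr
    _ = _ := by ring

/-- One relaxation step, written relative to the weighted mean. -/
theorem step_eq {A : Matrix (Fin N) (Fin N) ℝ} {ν : Fin N → ℝ} (hν : ∀ i, 0 < ν i)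
    {α : ℝ} {x y x' : Fin N → H}
    (hx' : ∀ i, x' i = (∑ j, A i j • x j) + α • ((1 / (N * ν i)) • y i - ∑ j, A i j • x j))
    (m : H) (i : Fin N) :
    x' i = m + (1 - α) • (∑ j, A i j • x j - m) + α • trackingDeviation ν y i
      + α • ((1 / (N : ℝ)) • ∑ j, y j - m) := by
  have h : (1 / (N * ν i)) • y i = trackingDeviation ν y i + (1 / (N : ℝ)) • ∑ j, y j := by
    rw [trackingDeviation, smul_sub, smul_smul]
    have hN : (N : ℝ) ≠ 0 := by
      have := i.pos
      positivity
    have : 1 / (N * ν i) * ν i = 1 / (N : ℝ) := by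
      have := (hν i).ne'
      field_simp
    rw [this]
    abel
  rw [hx', h]
  module

/-- Invariance of `π` under `A` removes the mixing term, leaving a relaxation step of the mean
perturbed by the tracking deviation. -/
theorem wmean_step {A : Matrix (Fin N) (Fin N) ℝ} {π ν : Fin N → ℝ} (hπA : π ᵥ* A = π)
    (hπ1 : ∑ i, π i = 1) (hν : ∀ i, 0 < ν i)
    {α : ℝ} {x y x' : Fin N → H}
    (hx' : ∀ i, x' i = (∑ j, A i j • x j) + α • ((1 / (N * ν i)) • y i - ∑ j, A i j • x j)) :
    wmean π x' = wmean π x + α • wmean π (trackingDeviation ν y)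
      + α • ((1 / (N : ℝ)) • ∑ j, y j - wmean π x) := by
  set m := wmean π x with hm
  have h0 : wmean π (fun i => ∑ j, A i j • x j - m) = 0 := by
    simp_rw [sub_eq_add_neg]
    rw [wmean_add, wmean_mulVec hπA, wmean_const hπ1, ← hm, add_neg_cancel]
  rw [funext (step_eq hν hx' m)]
  rw [wmean_add, wmean_add, wmean_add, wmean_const hπ1, wmean_const hπ1, wmean_smul, wmean_smul,
    h0, smul_zero, add_zero]

/-- The move towards the average of `y` is common to all nodes and cancels against the mean. -/
theorem consensusError_step_le {A : Matrix (Fin N) (Fin N) ℝ}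
    (hA : A ∈ Matrix.rowStochastic ℝ (Fin N)) {π ν : Fin N → ℝ} (hπA : π ᵥ* A = π)
    (hπ1 : ∑ i, π i = 1) (hν : ∀ i, 0 < ν i) {c₁ c₂ c₃ c₄ : ℝ}
    (hc : NormConstants π ν c₁ c₂ c₃ c₄) {ρ : ℝ} (hρ0 : 0 ≤ ρ)
    (hρ : ∀ x : Fin N → ℝ, wnorm π ((A - rowLimit π) *ᵥ x) ≤ ρ * wnorm π x)
    {α : ℝ} (hα0 : 0 ≤ α) (hα1 : α ≤ 1) {x y x' : Fin N → H}
    (hx' : ∀ i, x' i = (∑ j, A i j • x j) + α • ((1 / (N * ν i)) • y i - ∑ j, A i j • x j)) :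
    consensusError π x'
      ≤ (1 - α) * ρ * consensusError π x + α * theta₁ ν c₄ * trackingError ν y := by
  have hπ : ∀ i, 0 ≤ π i := fun i => (hc.pi_pos i).le
  have h : ∀ i, x' i - wmean π x' = (1 - α) • (∑ j, A i j • x j - wmean π x)
      + α • (trackingDeviation ν y i - wmean π (trackingDeviation ν y)) := by
    intro i
    rw [wmean_step hπA hπ1 hν hx', step_eq hν hx' (wmean π x) i]
    module
  unfold consensusError
  simp_rw [h]
  refine (wnorm_add_le _ _ _).trans ?_
  rw [wnorm_smul, wnorm_smul, abs_of_nonneg hα0, abs_of_nonneg (sub_nonneg.2 hα1), mul_assoc,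
    mul_assoc]
  refine add_le_add (mul_le_mul_of_nonneg_left (wnorm_row_deviation_le hA hπ hπ1 hρ0 hρ x)
    (sub_nonneg.2 hα1)) (mul_le_mul_of_nonneg_left ?_ hα0)
  exact (wnorm_sub_mean_le hπ hπ1 _).trans (wnorm_trackingDeviation_le hc hν y)

/-- The average of the local operators at the individual points is close to the global operator
at the mean. -/
theorem norm_average_sub_globalOp_le (hN : 0 < N) {F : Fin N → H → H} {K : ℝ} (hK : 0 ≤ K)
    (hF : ∀ i x y, ‖F i x - F i y‖ ≤ K * ‖x - y‖) {π : Fin N → ℝ} {c₁ : ℝ} (hc₁ : 0 < c₁)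
    (hπ : ∀ i, c₁ ^ 2 ≤ π i) (x : Fin N → H) :
    ‖(1 / (N : ℝ)) • ∑ i, F i (x i) - globalOp F (wmean π x)‖
      ≤ K / (√(N : ℝ) * c₁) * consensusError π x := by
  have hN' : (0 : ℝ) < N := by exact_mod_cast hN
  have h : (1 / (N : ℝ)) • ∑ i, F i (x i) - globalOp F (wmean π x)
      = ∑ i, (1 / (N : ℝ)) • (F i (x i) - F i (wmean π x)) := by
    rw [globalOp, ← smul_sub, ← Finset.sum_sub_distrib, Finset.smul_sum]
  rw [h]
  refine (norm_weighted_sum_le (w := fun _ => 1 / (N : ℝ)) (fun _ => by positivity)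
    (by simp [hN'.ne']) (fun i => F i (x i) - F i (wmean π x))).trans ?_
  refine wnorm_le_of_pointwise (fun _ => by positivity)
    (fun i => (sq_nonneg c₁).trans (hπ i)) (by positivity) fun i => ?_
  have h1 := pow_le_pow_left₀ (norm_nonneg _) (hF i (x i) (wmean π x)) 2
  have h2 : (K / (√(N : ℝ) * c₁)) ^ 2 = K ^ 2 / (N * c₁ ^ 2) := by
    rw [div_pow, mul_pow, Real.sq_sqrt hN'.le]
  rw [h2]
  calc 1 / (N : ℝ) * ‖F i (x i) - F i (wmean π x)‖ ^ 2
      ≤ 1 / (N : ℝ) * (K * ‖x i - wmean π x‖) ^ 2 := by gcongr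
    _ = K ^ 2 / (N * c₁ ^ 2) * (c₁ ^ 2 * ‖x i - wmean π x‖ ^ 2) := by field_simp
    _ ≤ _ := by
      gcongr
      exact hπ i

theorem wnorm_one_le {π : Fin N → ℝ} {c₁ : ℝ} (hc₁ : 0 < c₁) (hπ : ∀ i, c₁ ^ 2 ≤ π i)
    (x : Fin N → H) : wnorm (fun _ => 1) x ≤ wnorm π x / c₁ := by
  rw [div_eq_inv_mul]
  refine wnorm_le_of_pointwise (fun _ => zero_le_one)
    (fun i => (sq_nonneg c₁).trans (hπ i)) (by positivity) fun i => ?_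
  rw [one_mul, ← mul_assoc]
  refine le_mul_of_one_le_left (sq_nonneg _) ?_
  rw [inv_pow, ← div_eq_inv_mul, one_le_div (by positivity)]
  exact hπ i

theorem wnorm_one_const (v : H) :
    wnorm (fun _ : Fin N => 1) (fun _ => v) = √(N : ℝ) * ‖v‖ := by
  rw [← Real.sqrt_sq (wnorm_nonneg _ _), wnorm_sq (fun _ => zero_le_one)]
  simp only [one_mul, Finset.sum_const, Finset.card_univ, Fintype.card_fin, nsmul_eq_mul]
  rw [Real.sqrt_mul (Nat.cast_nonneg _), Real.sqrt_sq (norm_nonneg _)]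

/-- The displacement of `x` drives the tracking error through the increments of `F i`. The part
common to all nodes is compared with `F m - m`, whose norm is at most twice the distance to the
fixed points. -/
theorem wnorm_displacement_le (hN : 0 < N) {A : Matrix (Fin N) (Fin N) ℝ}
    (hA : A ∈ Matrix.rowStochastic ℝ (Fin N)) {π ν : Fin N → ℝ}
    (hπ1 : ∑ i, π i = 1) (hν : ∀ i, 0 < ν i) {c₁ c₂ c₃ c₄ : ℝ}
    (hc : NormConstants π ν c₁ c₂ c₃ c₄) {ρ : ℝ} (hρ0 : 0 ≤ ρ)
    (hρ : ∀ x : Fin N → ℝ, wnorm π ((A - rowLimit π) *ᵥ x) ≤ ρ * wnorm π x)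
    {F : Fin N → H → H} {K : ℝ} (hK : 0 ≤ K)
    (hF : ∀ i x y, ‖F i x - F i y‖ ≤ K * ‖x - y‖) (hqne : IsQuasiNonexpansive (globalOp F))
    (hfix : (Function.fixedPoints (globalOp F)).Nonempty)
    {α : ℝ} (hα0 : 0 ≤ α) {x y x' : Fin N → H}
    (hy : ∑ j, y j = ∑ j, F j (x j))
    (hx' : ∀ i, x' i = (∑ j, A i j • x j) + α • ((1 / (N * ν i)) • y i - ∑ j, A i j • x j)) :
    wnorm (fun _ => 1) (fun i => x' i - x i)
      ≤ (theta₄ A + α * (ρ + K)) / c₁ * consensusError π x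
        + α * theta₁ ν c₄ / c₁ * trackingError ν y
        + 2 * α * √(N : ℝ) *
          Metric.infDist (wmean π x) (Function.fixedPoints (globalOp F)) := by
  have hc₁ := hc.pos₁
  have hπ : ∀ i, 0 ≤ π i := fun i => (hc.pi_pos i).le
  set m := wmean π x with hm
  set d := Metric.infDist m (Function.fixedPoints (globalOp F)) with hd
  set a := consensusError π x with ha
  set b := trackingError ν y with hb
  have hsN : 0 < √(N : ℝ) := Real.sqrt_pos.2 (by exact_mod_cast hN)
  have h : ∀ i, x' i - x i = ((∑ j, (A - 1) i j • (x j - m)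
      + α • -(∑ j, A i j • x j - m)) + α • trackingDeviation ν y i)
      + α • ((1 / (N : ℝ)) • ∑ j, y j - m) := by
    intro i
    rw [sub_one_smul hA, step_eq hν hx' m i]
    module
  have t1 : wnorm (fun _ => 1) (fun i => ∑ j, (A - 1) i j • (x j - m)) ≤ theta₄ A * (a / c₁) :=
    (wnorm_matrix_le (fun _ => zero_le_one) (fun _ => zero_le_one) (opNormE_nonneg _)
      (wnorm_opNormE_le (A - 1)) _).trans
      (mul_le_mul_of_nonneg_left (wnorm_one_le hc₁ hc.sq_le_pi _) (opNormE_nonneg _))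
  have t2 : wnorm (fun _ => 1) (fun i => -(∑ j, A i j • x j - m)) ≤ ρ * a / c₁ := by
    rw [wnorm_neg]
    refine (wnorm_one_le hc₁ hc.sq_le_pi _).trans ?_
    gcongr
    exact wnorm_row_deviation_le hA hπ hπ1 hρ0 hρ x
  have t3 : wnorm (fun _ => 1) (trackingDeviation ν y) ≤ theta₁ ν c₄ * b / c₁ := by
    refine (wnorm_one_le hc₁ hc.sq_le_pi _).trans ?_
    gcongr
    exact wnorm_trackingDeviation_le hc hν y
  have t4 : ‖(1 / (N : ℝ)) • ∑ j, y j - m‖ ≤ K / (√(N : ℝ) * c₁) * a + 2 * d := by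
    rw [hy, ← sub_add_sub_cancel _ (globalOp F m) m]
    exact (norm_add_le _ _).trans (add_le_add
      (norm_average_sub_globalOp_le hN hK hF hc₁ hc.sq_le_pi x)
      (norm_sub_le_infDist hqne hfix m))
  -- The `√N` of a constant family cancels the `1 / √N` from Jensen's inequality, giving the summand
  -- `K` of `theta₃`.
  have t4' : √(N : ℝ) * ‖(1 / (N : ℝ)) • ∑ j, y j - m‖
      ≤ K / c₁ * a + 2 * √(N : ℝ) * d := by
    refine (mul_le_mul_of_nonneg_left t4 hsN.le).trans (le_of_eq ?_)
    field_simp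
  simp_rw [h]
  refine (wnorm_add_le _ _ _).trans ?_
  refine (add_le_add_left ((wnorm_add_le _ _ _).trans
    (add_le_add_left (wnorm_add_le _ _ _) _)) _).trans ?_
  rw [wnorm_smul, wnorm_smul, wnorm_smul, wnorm_one_const, abs_of_nonneg hα0]
  have e2 := mul_le_mul_of_nonneg_left t2 hα0
  have e3 := mul_le_mul_of_nonneg_left t3 hα0
  have e4 := mul_le_mul_of_nonneg_left t4' hα0
  have e : (theta₄ A + α * (ρ + K)) / c₁ * a + α * theta₁ ν c₄ / c₁ * b + 2 * α * √(N : ℝ) * d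
      = theta₄ A * (a / c₁) + α * (ρ * a / c₁) + α * (theta₁ ν c₄ * b / c₁)
        + α * (K / c₁ * a + 2 * √(N : ℝ) * d) := by ring
  rw [e]
  exact add_le_add (add_le_add (add_le_add t1 e2) e3) e4

theorem wnorm_sub_smul_sum_le {ν : Fin N → ℝ} (hν : ∀ i, 0 < ν i) (hν1 : ∑ i, ν i = 1)
    (z : Fin N → H) :
    wnorm (fun i => (ν i)⁻¹) (fun i => z i - ν i • ∑ j, z j)
      ≤ wnorm (fun i => (ν i)⁻¹) z := by
  rw [wnorm_inv_eq hν, wnorm_inv_eq hν]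
  have h := wnorm_sub_mean_le (fun i => (hν i).le) hν1 (fun i => (ν i)⁻¹ • z i)
  have e : ∀ i, (ν i)⁻¹ • (z i - ν i • ∑ j, z j)
      = (ν i)⁻¹ • z i - ∑ j, ν j • (ν j)⁻¹ • z j := by
    intro i
    simp only [smul_sub, smul_smul, inv_mul_cancel₀ (hν i).ne', mul_inv_cancel₀ (hν _).ne',
      one_smul]
  simp_rw [e]
  exact h

theorem trackingError_step_le {B : Matrix (Fin N) (Fin N) ℝ}
    (hB : B ∈ Matrix.colStochastic ℝ (Fin N)) {π ν : Fin N → ℝ} (hν : ∀ i, 0 < ν i)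
    (hν1 : ∑ i, ν i = 1) (hνB : B *ᵥ ν = ν) {c₁ c₂ c₃ c₄ : ℝ}
    (hc : NormConstants π ν c₁ c₂ c₃ c₄) {ρ : ℝ} (hρ0 : 0 ≤ ρ)
    (hρ : ∀ x : Fin N → ℝ, wnorm (fun i => (ν i)⁻¹) ((B - colLimit ν) *ᵥ x)
      ≤ ρ * wnorm (fun i => (ν i)⁻¹) x)
    {F : Fin N → H → H} {K : ℝ} (hK : 0 ≤ K)
    (hF : ∀ i x y, ‖F i x - F i y‖ ≤ K * ‖x - y‖) {x x' y y' : Fin N → H}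
    (hy' : ∀ i, y' i = (∑ j, B i j • y j) + F i (x' i) - F i (x i)) :
    trackingError ν y' ≤ ρ * trackingError ν y
      + c₂ * K / c₃ * wnorm (fun _ => 1) (fun i => x' i - x i) := by
  have hBsum : ∀ j, ∑ i, B i j = 1 := (Matrix.mem_colStochastic_iff_sum.1 hB).2
  have hνi : ∀ i, 0 ≤ (ν i)⁻¹ := fun i => (inv_pos.2 (hν i)).le
  set S := ∑ j, y j with hS
  have hBy : ∑ i, ∑ j, B i j • y j = S := by
    rw [Finset.sum_comm]
    exact Finset.sum_congr rfl fun j _ => by rw [← Finset.sum_smul, hBsum, one_smul]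
  -- The deviation has zero sum, so `colLimit ν` annihilates it and `B` may be replaced by `B -
  -- colLimit ν`.
  have hz : ∑ j, (y j - ν j • S) = 0 := by
    rw [Finset.sum_sub_distrib, ← Finset.sum_smul, hν1, one_smul, ← hS, sub_self]
  have hBν : ∀ i, ∑ j, B i j * ν j = ν i := fun i => congrFun hνB i
  have h1 : ∀ i, ∑ j, (B - colLimit ν) i j • (y j - ν j • S)
      = ∑ j, B i j • y j - ν i • S := by
    intro i
    simp only [Matrix.sub_apply, colLimit, Matrix.of_apply, sub_smul, Finset.sum_sub_distrib]
    rw [← Finset.smul_sum, hz, smul_zero, sub_zero]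
    simp only [smul_sub, Finset.sum_sub_distrib, smul_smul]
    rw [← Finset.sum_smul, hBν]
  have h2 : ∀ i, y' i - ν i • ∑ j, y' j = ∑ j, (B - colLimit ν) i j • (y j - ν j • S)
      + ((F i (x' i) - F i (x i)) - ν i • ∑ j, (F j (x' j) - F j (x j))) := by
    intro i
    have : ∑ j, y' j = S + ∑ j, (F j (x' j) - F j (x j)) := by
      simp_rw [hy', add_sub_assoc]
      rw [Finset.sum_add_distrib, hBy]
    rw [h1, this, hy']
    module
  unfold trackingError
  simp_rw [h2]
  refine (wnorm_add_le _ _ _).trans (add_le_add (wnorm_matrix_le hνi hνi hρ0 hρ _) ?_)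
  refine (wnorm_sub_smul_sum_le hν hν1 _).trans ?_
  have hc₂ := hc.pos₂
  have hc₃ := hc.pos₃
  refine wnorm_le_of_pointwise hνi (fun _ => zero_le_one) (by positivity) fun i => ?_
  have e1 : (ν i)⁻¹ ≤ c₂ ^ 2 / c₃ ^ 2 := by
    rw [le_div_iff₀' (by positivity)]
    exact (hc.nu_le_pi (fun i => (hν i).le) i).trans (hc.pi_le_sq i)
  have e2 := pow_le_pow_left₀ (norm_nonneg _) (hF i (x' i) (x i)) 2
  have := hνi i
  calc (ν i)⁻¹ * ‖F i (x' i) - F i (x i)‖ ^ 2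
      ≤ c₂ ^ 2 / c₃ ^ 2 * (K * ‖x' i - x i‖) ^ 2 := by gcongr
    _ = _ := by ring

/-- The new mean is an exact relaxation step plus a perturbation, and the distance to a set is
1-Lipschitz. -/
theorem infDist_step_le (hN : 0 < N) {A : Matrix (Fin N) (Fin N) ℝ} {π ν : Fin N → ℝ}
    (hπA : π ᵥ* A = π) (hπ1 : ∑ i, π i = 1) (hν : ∀ i, 0 < ν i) {c₁ c₂ c₃ c₄ : ℝ}
    (hc : NormConstants π ν c₁ c₂ c₃ c₄)
    {F : Fin N → H → H} {K : ℝ} (hK : 0 ≤ K)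
    (hF : ∀ i x y, ‖F i x - F i y‖ ≤ K * ‖x - y‖) (hqne : IsQuasiNonexpansive (globalOp F))
    (hfix : (Function.fixedPoints (globalOp F)).Nonempty)
    {κ : ℝ} (hreg : IsLinearlyRegular (globalOp F) κ)
    {α δ : ℝ} (hα0 : 0 ≤ α) (hδ : 0 ≤ δ) (hαδ : α ≤ 1 - δ) {x y x' : Fin N → H}
    (hy : ∑ j, y j = ∑ j, F j (x j))
    (hx' : ∀ i, x' i = (∑ j, A i j • x j) + α • ((1 / (N * ν i)) • y i - ∑ j, A i j • x j)) :
    Metric.infDist (wmean π x') (Function.fixedPoints (globalOp F))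
      ≤ α * (K / (√(N : ℝ) * c₁)) * consensusError π x + α * theta₁ ν c₄ * trackingError ν y
        + (1 - δ * α / (4 * κ ^ 2)) *
          Metric.infDist (wmean π x) (Function.fixedPoints (globalOp F)) := by
  have hπ : ∀ i, 0 ≤ π i := fun i => (hc.pi_pos i).le
  set m := wmean π x with hm
  have h : wmean π x' - (m + α • (globalOp F m - m))
      = α • ((1 / (N : ℝ)) • ∑ j, F j (x j) - globalOp F m)
        + α • wmean π (trackingDeviation ν y) := by
    rw [wmean_step hπA hπ1 hν hx', hy]
    module
  have t1 := norm_average_sub_globalOp_le hN hK hF hc.pos₁ hc.sq_le_pi x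
  have t2 : ‖wmean π (trackingDeviation ν y)‖ ≤ theta₁ ν c₄ * trackingError ν y :=
    (norm_weighted_sum_le hπ hπ1 _).trans (wnorm_trackingDeviation_le hc hν y)
  have t3 : dist (wmean π x') (m + α • (globalOp F m - m))
      ≤ α * (K / (√(N : ℝ) * c₁) * consensusError π x)
        + α * (theta₁ ν c₄ * trackingError ν y) := by
    rw [dist_eq_norm, h]
    refine (norm_add_le _ _).trans ?_
    rw [norm_smul, norm_smul, Real.norm_eq_abs, abs_of_nonneg hα0]
    exact add_le_add (mul_le_mul_of_nonneg_left t1 hα0) (mul_le_mul_of_nonneg_left t2 hα0)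
  have t4 := infDist_relaxation_le hqne hfix hreg m hα0 hδ hαδ
  have t5 := Metric.infDist_le_infDist_add_dist (s := Function.fixedPoints (globalOp F))
    (x := wmean π x') (y := m + α • (globalOp F m - m))
  linarith

/-- Decay of the distance to the fixed point set alone does not make the means converge; summable
increments do. -/
theorem norm_wmean_step_sub_le (hN : 0 < N) {A : Matrix (Fin N) (Fin N) ℝ} {π ν : Fin N → ℝ}
    (hπA : π ᵥ* A = π) (hπ1 : ∑ i, π i = 1) (hν : ∀ i, 0 < ν i) {c₁ c₂ c₃ c₄ : ℝ}
    (hc : NormConstants π ν c₁ c₂ c₃ c₄)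
    {F : Fin N → H → H} {K : ℝ} (hK : 0 ≤ K)
    (hF : ∀ i x y, ‖F i x - F i y‖ ≤ K * ‖x - y‖) (hqne : IsQuasiNonexpansive (globalOp F))
    (hfix : (Function.fixedPoints (globalOp F)).Nonempty)
    {α : ℝ} (hα0 : 0 ≤ α) {x y x' : Fin N → H}
    (hy : ∑ j, y j = ∑ j, F j (x j))
    (hx' : ∀ i, x' i = (∑ j, A i j • x j) + α • ((1 / (N * ν i)) • y i - ∑ j, A i j • x j)) :
    ‖wmean π x' - wmean π x‖
      ≤ α * (K / (√(N : ℝ) * c₁) * consensusError π x + theta₁ ν c₄ * trackingError ν y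
        + 2 * Metric.infDist (wmean π x) (Function.fixedPoints (globalOp F))) := by
  have hπ : ∀ i, 0 ≤ π i := fun i => (hc.pi_pos i).le
  set m := wmean π x with hm
  have h : wmean π x' - m
      = α • (((1 / (N : ℝ)) • ∑ j, F j (x j) - globalOp F m)
        + wmean π (trackingDeviation ν y) + (globalOp F m - m)) := by
    rw [wmean_step hπA hπ1 hν hx', hy]
    module
  rw [h, norm_smul, Real.norm_eq_abs, abs_of_nonneg hα0]
  refine mul_le_mul_of_nonneg_left ((norm_add₃_le).trans (add_le_add (add_le_add ?_ ?_) ?_)) hα0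
  · exact norm_average_sub_globalOp_le hN hK hF hc.pos₁ hc.sq_le_pi x
  · exact (norm_weighted_sum_le hπ hπ1 _).trans (wnorm_trackingDeviation_le hc hν y)
  · exact norm_sub_le_infDist hqne hfix m

theorem IsTrajectory.sum_y {F : Fin N → H → H} {A B : Matrix (Fin N) (Fin N) ℝ}
    {ν : Fin N → ℝ} {α : ℝ} {x y : ℕ → Fin N → H} (h : IsTrajectory F A B ν α x y)
    (hB : B ∈ Matrix.colStochastic ℝ (Fin N)) (k : ℕ) :
    ∑ j, y k j = ∑ j, F j (x k j) := by
  have hBsum : ∀ j, ∑ i, B i j = 1 := (Matrix.mem_colStochastic_iff_sum.1 hB).2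
  induction k with
  | zero => exact Finset.sum_congr rfl fun i _ => h.init i
  | succ k ih =>
    have hBy : ∑ i, ∑ j, B i j • y k j = ∑ j, y k j := by
      rw [Finset.sum_comm]
      exact Finset.sum_congr rfl fun j _ => by rw [← Finset.sum_smul, hBsum, one_smul]
    simp_rw [h.step_y]
    rw [Finset.sum_sub_distrib, Finset.sum_add_distrib, hBy, ih]
    abel

end Step

/-! ### The determinant and passage to the limit -/

section Convergence

variable {N : ℕ} {H : Type*} [NormedAddCommGroup H] [InnerProductSpace ℝ H]

/-- `det (I - M(α)) / α`. -/
def reducedDet (ρ₁ ρ₂ c₁ c₂ θ₁ θ₂ θ₃ θ₄ K s e α : ℝ) : ℝ :=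
  (1 - (1 - α) * ρ₁) *
      ((1 - (ρ₂ + α * θ₁ * θ₂)) * e - 2 * α * c₁ * θ₂ * (s * θ₁ / c₁))
    - α * c₂ * θ₁ * (θ₂ * (α * θ₃ + θ₄) * e + 2 * α * c₁ * θ₂ * (K / c₁))

/-- The third row of `I - M(α)` is divisible by `α`; dividing it out removes the trivial root at
zero. -/
theorem det_one_sub_matM (A B : Matrix (Fin N) (Fin N) ℝ) (π ν : Fin N → ℝ)
    (c₁ c₂ c₃ c₄ K κ δ α : ℝ) :
    (1 - matM A B π ν c₁ c₂ c₃ c₄ K κ δ α).det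
      = α * reducedDet (rho₁ A π) (rho₂ B ν) c₁ c₂ (theta₁ ν c₄) (theta₂ N c₁ c₂ c₃ K)
          (theta₃ A π K) (theta₄ A) K √(N : ℝ) (δ / (4 * κ ^ 2)) α := by
  rw [Matrix.det_fin_three]
  simp only [matM, Matrix.sub_apply, Matrix.one_apply, Matrix.of_apply, Matrix.cons_val',
    Matrix.cons_val_zero, Matrix.cons_val_one, Matrix.cons_val, reducedDet]
  simp
  ring

theorem exists_isLeast_root_reducedDet {ρ₁ ρ₂ c₁ c₂ θ₁ θ₂ θ₃ θ₄ K s e : ℝ}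
    (hρ₁ : 0 ≤ ρ₁) (hρ₁' : ρ₁ < 1) (hρ₂ : ρ₂ < 1) (hc₁ : 0 < c₁) (hc₂ : 0 < c₂) (hθ₁ : 0 < θ₁)
    (hθ₂ : 0 < θ₂) (hθ₃ : 0 ≤ θ₃) (hθ₄ : 0 ≤ θ₄) (hK : 0 < K) (hs : 0 < s) (he : 0 < e) :
    ∃ c, IsLeast {a : ℝ | 0 < a ∧ reducedDet ρ₁ ρ₂ c₁ c₂ θ₁ θ₂ θ₃ θ₄ K s e a = 0} c ∧
      ∀ a, 0 < a → a < c → 0 < reducedDet ρ₁ ρ₂ c₁ c₂ θ₁ θ₂ θ₃ θ₄ K s e a := by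
  have h1 : 0 < 1 - ρ₁ := sub_pos.2 hρ₁'
  have h2 : 0 < 1 - ρ₂ := sub_pos.2 hρ₂
  -- This `b` makes `1 - (ρ₂ + b θ₁ θ₂)` vanish, so only negative terms remain.
  refine exists_isLeast_root (b := (1 - ρ₂) / (θ₁ * θ₂)) ?_ ?_ (by positivity) ?_
  · unfold reducedDet
    fun_prop
  · have : reducedDet ρ₁ ρ₂ c₁ c₂ θ₁ θ₂ θ₃ θ₄ K s e 0 = (1 - ρ₁) * ((1 - ρ₂) * e) := by
      unfold reducedDet
      ring
    rw [this]
    positivity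
  · set b := (1 - ρ₂) / (θ₁ * θ₂) with hb
    have hb0 : 0 < b := by positivity
    have hbe : b * θ₁ * θ₂ = 1 - ρ₂ := by rw [hb]; field_simp
    have : reducedDet ρ₁ ρ₂ c₁ c₂ θ₁ θ₂ θ₃ θ₄ K s e b
        = -(((1 - ρ₁) + b * ρ₁) * (2 * b * c₁ * θ₂ * (s * θ₁ / c₁))
          + b * c₂ * θ₁ * (θ₂ * (b * θ₃ + θ₄) * e + 2 * b * c₁ * θ₂ * (K / c₁))) := by
      unfold reducedDet
      rw [hbe]
      ring
    rw [this, neg_lt_zero]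
    positivity

theorem tendsto_zero_of_le_geometric {f : ℕ → ℝ} {C r : ℝ} (hr : 0 ≤ r) (hr1 : r < 1)
    (hf0 : ∀ k, 0 ≤ f k) (hf : ∀ k, f k ≤ C * r ^ k) : Tendsto f atTop (𝓝 0) :=
  squeeze_zero hf0 hf (by simpa using (tendsto_pow_atTop_nhds_zero_of_lt_one hr hr1).const_mul C)

/-- A sequence with geometrically decaying increments whose distance to a closed set tends to zero
converges geometrically to a point of that set. -/
theorem exists_mem_norm_sub_le {E : Type*} [NormedAddCommGroup E] [CompleteSpace E] {s : Set E} (hs : IsClosed s)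
    (hne : s.Nonempty) {m : ℕ → E} {C D r : ℝ} (hr : 0 ≤ r) (hr1 : r < 1)
    (hm : ∀ k, ‖m (k + 1) - m k‖ ≤ C * r ^ k) (hd : ∀ k, Metric.infDist (m k) s ≤ D * r ^ k) :
    ∃ p ∈ s, ∀ k, ‖m k - p‖ ≤ C / (1 - r) * r ^ k := by
  have hm' : ∀ k, dist (m k) (m (k + 1)) ≤ C * r ^ k := fun k => by
    rw [dist_comm, dist_eq_norm]
    exact hm k
  obtain ⟨p, hp⟩ := cauchySeq_tendsto_of_complete (cauchySeq_of_le_geometric r C hr1 hm')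
  refine ⟨p, ?_, fun k => ?_⟩
  · rw [hs.mem_iff_infDist_zero hne]
    exact tendsto_nhds_unique (((Metric.continuous_infDist_pt s).tendsto p).comp hp)
      (tendsto_zero_of_le_geometric hr hr1 (fun _ => Metric.infDist_nonneg) hd)
  · rw [← dist_eq_norm]
    exact (dist_le_of_le_geometric_of_tendsto r C hr1 hm' hp k).trans (le_of_eq (by ring))

/-- Regularity and the residual bound give `d ≤ 2 κ d`. This covers the values of `κ` for which the
corner entry of `M(α)` might be negative. -/
theorem infDist_eq_zero_of_regular {E : Type*} [NormedAddCommGroup E] {T : E → E}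
    (hT : IsQuasiNonexpansive T)
    (hne : (Function.fixedPoints T).Nonempty) {κ : ℝ} (hreg : IsLinearlyRegular T κ)
    (hκ : κ < 1 / 2) (x : E) : Metric.infDist x (Function.fixedPoints T) = 0 := by
  have h1 := hreg.2 x
  have h2 := mul_le_mul_of_nonneg_left (norm_sub_le_infDist hT hne x) hreg.1.le
  have h3 : 0 ≤ Metric.infDist x (Function.fixedPoints T) := Metric.infDist_nonneg
  nlinarith

/-- If the error triple of a trajectory decays geometrically, the trajectory converges
geometrically to a fixed point. -/
theorem IsTrajectory.exists_limit [CompleteSpace H] (hN : 0 < N)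
    {A B : Matrix (Fin N) (Fin N) ℝ} (hB : B ∈ Matrix.colStochastic ℝ (Fin N))
    {π ν : Fin N → ℝ} (hπA : π ᵥ* A = π) (hπ1 : ∑ i, π i = 1) (hν : ∀ i, 0 < ν i)
    {c₁ c₂ c₃ c₄ : ℝ} (hc : NormConstants π ν c₁ c₂ c₃ c₄)
    {F : Fin N → H → H} {K : ℝ} (hK : 0 ≤ K)
    (hF : ∀ i x y, ‖F i x - F i y‖ ≤ K * ‖x - y‖) (hqne : IsQuasiNonexpansive (globalOp F))
    (hfix : (Function.fixedPoints (globalOp F)).Nonempty) (hcont : Continuous (globalOp F))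
    {α : ℝ} (hα0 : 0 ≤ α) {x y : ℕ → Fin N → H} (h : IsTrajectory F A B ν α x y)
    {C r : ℝ} (hr : 0 ≤ r) (hr1 : r < 1)
    (ha : ∀ k, consensusError π (x k) ≤ C * r ^ k)
    (hb : ∀ k, trackingError ν (y k) ≤ C * r ^ k)
    (hd : ∀ k, Metric.infDist (wmean π (x k)) (Function.fixedPoints (globalOp F)) ≤ C * r ^ k) :
    ∃ p ∈ Function.fixedPoints (globalOp F), ∃ D : ℝ, ∀ k i, ‖x k i - p‖ ≤ D * r ^ k := by
  have hc₁ := hc.pos₁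
  have hc₄ := hc.pos₄
  have hθ : 0 ≤ theta₁ ν c₄ := by
    have := opNormE_nonneg (Matrix.diagonal ν)⁻¹
    unfold theta₁
    positivity
  have hinc : ∀ k, ‖wmean π (x (k + 1)) - wmean π (x k)‖
      ≤ α * (K / (√(N : ℝ) * c₁) * C + theta₁ ν c₄ * C + 2 * C) * r ^ k := by
    intro k
    refine (norm_wmean_step_sub_le hN hπA hπ1 hν hc hK hF hqne hfix hα0 (h.sum_y hB k)
      (h.step_x k)).trans ?_
    have e1 := mul_le_mul_of_nonneg_left (ha k)
      (show 0 ≤ K / (√(N : ℝ) * c₁) by positivity)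
    have e2 := mul_le_mul_of_nonneg_left (hb k) hθ
    have e3 := hd k
    rw [mul_assoc]
    refine mul_le_mul_of_nonneg_left ?_ hα0
    linarith
  obtain ⟨p, hp, hpk⟩ := exists_mem_norm_sub_le (isClosed_fixedPoints hcont) hfix hr hr1 hinc hd
  refine ⟨p, hp, C / c₁ + α * (K / (√(N : ℝ) * c₁) * C + theta₁ ν c₄ * C + 2 * C) / (1 - r),
    fun k i => ?_⟩
  have h1 : ‖x k i - wmean π (x k)‖ ≤ C / c₁ * r ^ k := by
    have e1 := norm_le_wnorm (w := fun _ => (1 : ℝ)) (fun _ => zero_le_one)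
      (fun i => x k i - wmean π (x k)) i
    rw [Real.sqrt_one, one_mul] at e1
    refine (e1.trans (wnorm_one_le hc₁ hc.sq_le_pi _)).trans ?_
    rw [div_mul_eq_mul_div]
    exact div_le_div_of_nonneg_right (ha k) hc₁.le
  have h2 := norm_add_le (x k i - wmean π (x k)) (wmean π (x k) - p)
  rw [sub_add_sub_cancel] at h2
  rw [add_mul]
  exact h2.trans (add_le_add h1 (hpk k))

end Convergence
end DOT
end

/-! ### Assembly of the convergence theorem -/

theorem theorem1 {H : Type*} [NormedAddCommGroup H] [InnerProductSpace ℝ H] [CompleteSpace H]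
    (N : ℕ) (hN : 0 < N)
    -- strongly connected communication graph with consistent communication matrices
    (G : Digraph (Fin N)) (hG : DOT.IsStronglyConnected G)
    (A B : Matrix (Fin N) (Fin N) ℝ)
    (hA : A ∈ Matrix.rowStochastic ℝ (Fin N)) (hB : B ∈ Matrix.colStochastic ℝ (Fin N))
    (hGA : DOT.IsConsistent G A) (hGB : DOT.IsConsistent G B)
    -- left stochastic eigenvector of `A`, right stochastic eigenvector of `B`
    (π ν : Fin N → ℝ)
    (hπ : π ∈ stdSimplex ℝ (Fin N)) (hπA : π ᵥ* A = π)
    (hν : ν ∈ stdSimplex ℝ (Fin N)) (hνB : B *ᵥ ν = ν)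
    -- local operators and the global operator
    (F : Fin N → H → H) (L : Fin N → ℝ) (hL : ∀ i, DOT.IsLipschitz (F i) (L i))
    (hqne : DOT.IsQuasiNonexpansive (DOT.globalOp F))
    (hfix : (Function.fixedPoints (DOT.globalOp F)).Nonempty)
    (κ : ℝ) (hreg : DOT.IsLinearlyRegular (DOT.globalOp F) κ)
    -- norm equivalence constants and the parameter `δ`
    (c₁ c₂ c₃ c₄ : ℝ) (hc : DOT.NormConstants π ν c₁ c₂ c₃ c₄)
    (δ : ℝ) (hδ₀ : 0 < δ) (hδ₁ : δ < 1) :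
    ∃ α_c : ℝ,
      IsLeast {a : ℝ | 0 < a ∧
        (1 - DOT.matM A B π ν c₁ c₂ c₃ c₄ (⨆ i, L i) κ δ a).det = 0} α_c ∧
      ∀ α : ℝ, 0 < α → α < min (1 - δ) α_c →
        ∃ r : ℝ, 0 ≤ r ∧ r < 1 ∧
          ∀ x y : ℕ → Fin N → H, DOT.IsTrajectory F A B ν α x y →
            ∃ xstar ∈ Function.fixedPoints (DOT.globalOp F), ∃ C : ℝ,
              ∀ k i, ‖x k i - xstar‖ ≤ C * r ^ k := by
  open DOT in
  obtain ⟨hκ, -⟩ := id hreg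
  have hπ1 := hπ.2
  have hν1 := hν.2
  have hνpos := hc.nu_pos hν.1
  have hc₁ := hc.pos₁
  have hc₂ := hc.pos₂
  have hc₃ := hc.pos₃
  have hc₄ := hc.pos₄
  have hN' : (1 : ℝ) ≤ N := by exact_mod_cast hN
  have hs : (1 : ℝ) ≤ √(N : ℝ) := Real.one_le_sqrt.2 hN'
  obtain ⟨hρ₁0, hρ₁1, hρ₁⟩ := rho₁_spec hG hGA hA hc.pi_pos hπ1 hπA
  obtain ⟨hρ₂0, hρ₂1, hρ₂⟩ := rho₂_spec hG hGB hB hνpos hν1 hνB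
  have hLK : ∀ i, L i ≤ ⨆ i, L i := fun i => le_ciSup (Set.finite_range L).bddAbove i
  have hK : 0 < ⨆ i, L i := (hL ⟨0, hN⟩).1.trans_le (hLK _)
  have hF : ∀ i x y, ‖F i x - F i y‖ ≤ (⨆ i, L i) * ‖x - y‖ := fun i x y =>
    ((hL i).2 x y).trans (mul_le_mul_of_nonneg_right (hLK i) (norm_nonneg _))
  generalize (⨆ i, L i) = K at hK hF ⊢
  have hθ₁ : 0 < theta₁ ν c₄ := by
    have := (inv_pos.2 (hνpos ⟨0, hN⟩)).trans_le (inv_le_opNormE_diagonal_inv hνpos ⟨0, hN⟩)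
    unfold theta₁
    positivity
  have hθ₂ : 0 < theta₂ N c₁ c₂ c₃ K := by
    unfold theta₂
    positivity
  have hθ₃ : 0 ≤ theta₃ A π K := add_nonneg hρ₁0 hK.le
  have hθ₄ : 0 ≤ theta₄ A := opNormE_nonneg _
  have he : 0 < δ / (4 * κ ^ 2) := by positivity
  obtain ⟨α_c, hleast, hpos⟩ := exists_isLeast_root_reducedDet hρ₁0 hρ₁1 hρ₂1 hc₁ hc₂ hθ₁ hθ₂
    hθ₃ hθ₄ hK (zero_lt_one.trans_le hs) he
  refine ⟨α_c, ?_, fun α hα hα' => ?_⟩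
  · convert hleast using 1
    ext a
    refine and_congr_right fun ha => ?_
    rw [det_one_sub_matM, mul_eq_zero, or_iff_right ha.ne']
  have hα1 : α ≤ 1 - δ := (hα'.trans_le (min_le_left _ _)).le
  have hα2 : 0 ≤ 1 - α := by linarith
  have hdet := mul_pos hα (hpos α hα (hα'.trans_le (min_le_right _ _)))
  have h11 : (1 - α) * rho₁ A π < 1 := by nlinarith
  obtain ⟨r, v₁, v₂, v₃, hr0, hr1, hv₁, hv₂, hv₃, q1, q2, q3⟩ :=
    exists_positive_contracted_vector (m₁₁ := (1 - α) * rho₁ A π)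
      (m₁₂ := α * c₂ * theta₁ ν c₄)
      (m₂₁ := theta₂ N c₁ c₂ c₃ K * (α * theta₃ A π K + theta₄ A))
      (m₂₂ := rho₂ B ν + α * theta₁ ν c₄ * theta₂ N c₁ c₂ c₃ K)
      (m₂₃ := 2 * α * c₁ * theta₂ N c₁ c₂ c₃ K) (m₃₁ := α * K / c₁)
      (m₃₂ := α * √(N : ℝ) * theta₁ ν c₄ / c₁) (e := δ * α / (4 * κ ^ 2))
      h11 (by positivity) (by positivity) (by positivity) (by positivity) (by positivity)
      (by positivity) (lt_of_lt_of_eq hdet (by unfold reducedDet; ring))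
  refine ⟨r, hr0.le, hr1, fun x y hxy => ?_⟩
  have ha0 : ∀ k, 0 ≤ consensusError π (x k) := fun k => wnorm_nonneg _ _
  have hb0 : ∀ k, 0 ≤ trackingError ν (y k) := fun k => wnorm_nonneg _ _
  have hd0 : ∀ k, 0 ≤ Metric.infDist (wmean π (x k)) (Function.fixedPoints (globalOp F)) :=
    fun k => Metric.infDist_nonneg
  -- This and the next bound relax the sharper one-step estimates to the entries of `M(α)`.
  have hsc : 1 ≤ √(N : ℝ) * c₂ := hc.one_le hπ1
  have hc₁s : c₁ ≤ √(N : ℝ) := by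
    have e1 : c₁ ^ 2 ≤ 1 := (hc.sq_le_pi ⟨0, hN⟩).trans (by
      rw [← hπ1]
      exact Finset.single_le_sum (fun i _ => hπ.1 i) (Finset.mem_univ _))
    nlinarith
  -- The consensus error is scaled by `c₂` to match the factor `c₂` in the entry `m₁₂`.
  obtain ⟨C, hC0, hC⟩ := exists_geometric_bound (m₃₃ := 1 - δ * α / (4 * κ ^ 2))
    (a := fun k => c₂ * consensusError π (x k))
    (b := fun k => trackingError ν (y k))
    (d := fun k => Metric.infDist (wmean π (x k)) (Function.fixedPoints (globalOp F)))
    (by positivity) (by positivity) (by positivity) (by positivity) (by positivity)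
    (by positivity) (by positivity) hr0 hv₁ hv₂ hv₃ q1 q2 q3
    (fun k => by
      have e1 := mul_le_mul_of_nonneg_left (consensusError_step_le hA hπA hπ1 hνpos hc hρ₁0 hρ₁
        hα.le (by linarith) (hxy.step_x k)) hc₂.le
      linarith)
    (fun k => by
      have e1 := trackingError_step_le hB hνpos hν1 hνB hc hρ₂0 hρ₂ hK.le hF (hxy.step_y k)
      have e2 := wnorm_displacement_le hN hA hπ1 hνpos hc hρ₁0 hρ₁ hK.le hF hqne hfix hα.le
        (hxy.sum_y hB k) (hxy.step_x k)
      have e3 := mul_le_mul_of_nonneg_left e2 (show 0 ≤ c₂ * K / c₃ by positivity)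
      refine e1.trans ((add_le_add_right e3 _).trans ?_)
      have ha := ha0 k
      have hb := hb0 k
      have hd := hd0 k
      -- Here `t` is `theta₂` without its factor `√N + 1`; `g1`, `g2` and `g3` record the slack
      -- which that factor leaves in the three terms.
      obtain ⟨t, ht⟩ : ∃ t, t = c₂ * K / (c₁ * c₃) := ⟨_, rfl⟩
      have ht0 : 0 ≤ t := by rw [ht]; positivity
      have w1 : theta₂ N c₁ c₂ c₃ K = t * (√(N : ℝ) + 1) := by
        rw [ht, theta₂]; ring
      have w2 : c₂ * K / c₃ = t * c₁ := by rw [ht]; field_simp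
      rw [w1, w2]
      have g1 : t * (α * theta₃ A π K + theta₄ A) * consensusError π (x k) * 1
          ≤ t * (α * theta₃ A π K + theta₄ A) * consensusError π (x k)
            * ((√(N : ℝ) + 1) * c₂) :=
        mul_le_mul_of_nonneg_left (by linarith) (by positivity)
      have g2 : 0 ≤ α * theta₁ ν c₄ * t * √(N : ℝ) * trackingError ν (y k) := by positivity
      have g3 : 0 ≤ 2 * α * t * c₁ *
          Metric.infDist (wmean π (x k)) (Function.fixedPoints (globalOp F)) := by positivity
      have g4 : t * c₁ * ((theta₄ A + α * (rho₁ A π + K)) / c₁ * consensusError π (x k)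
            + α * theta₁ ν c₄ / c₁ * trackingError ν (y k)
            + 2 * α * √(N : ℝ) *
              Metric.infDist (wmean π (x k)) (Function.fixedPoints (globalOp F)))
          = t * (α * theta₃ A π K + theta₄ A) * consensusError π (x k)
            + α * theta₁ ν c₄ * t * trackingError ν (y k)
            + 2 * α * t * c₁ * √(N : ℝ) *
              Metric.infDist (wmean π (x k)) (Function.fixedPoints (globalOp F)) := by
        rw [theta₃]
        field_simp
        ring
      rw [g4]
      linarith)
    (fun k => by
      have e1 := infDist_step_le hN hπA hπ1 hνpos hc hK.le hF hqne hfix hreg hα.le hδ₀.le hα1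
        (hxy.sum_y hB k) (hxy.step_x k)
      refine e1.trans (add_le_add_left (add_le_add ?_ ?_) _)
      · have e2 : α * (K / (√(N : ℝ) * c₁)) ≤ α * K / c₁ * c₂ := by
          rw [mul_div_assoc', div_mul_eq_mul_div, div_le_div_iff₀ (by positivity) hc₁]
          have := mul_le_mul_of_nonneg_left hsc (show 0 ≤ α * K * c₁ by positivity)
          linarith
        rw [← mul_assoc]
        exact mul_le_mul_of_nonneg_right e2 (ha0 k)
      · refine mul_le_mul_of_nonneg_right ?_ (hb0 k)
        rw [le_div_iff₀ hc₁]
        have := mul_le_mul_of_nonneg_left hc₁s (show 0 ≤ α * theta₁ ν c₄ by positivity)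
        linarith)
    (by
      rcases lt_or_ge κ (1 / 2) with hκ2 | hκ2
      · exact Or.inr fun k => infDist_eq_zero_of_regular hqne hfix hreg hκ2 _
      · refine Or.inl (sub_nonneg.2 ((div_le_one (by positivity)).2 ?_))
        nlinarith)
  -- The term `C / c₂` undoes the scaling of the consensus error.
  refine hxy.exists_limit (C := max C (C / c₂)) hN hB hπA hπ1 hνpos hc hK.le hF hqne hfix
    (continuous_globalOp hL) hα.le hr0.le hr1 (fun k => ?_) (fun k => ?_) (fun k => ?_)
  · have e1 := (hC k).1
    have e2 : consensusError π (x k) ≤ C / c₂ * r ^ k := by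
      rw [div_mul_eq_mul_div, le_div_iff₀' hc₂]
      exact e1
    exact e2.trans (mul_le_mul_of_nonneg_right (le_max_right _ _) (by positivity))
  · exact (hC k).2.1.trans (mul_le_mul_of_nonneg_right (le_max_left _ _) (by positivity))
  · exact (hC k).2.2.trans (mul_le_mul_of_nonneg_right (le_max_left _ _) (by positivity))
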